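/- Let $0<r<1$ and let $A_r=\{z\in\mathbb{C}: r<|z|<1\}$. Let $\mathscr{H}^2(A_r)$ be the Hilbert function space on $A_r$ with reproducing kernel $$k_{A_r}(\lambda,\mu)=\frac{1-r^2}{(1-\lambda\bar\mu)\bigl(1-r^2/(\lambda\bar\mu)\bigr)},\qquad \lambda,\mu\in A_r,$$ that is, the completion of the linear span of the functions $k_{A_r}(\cdot,\mu)$, $\mu\in A_r$, with respect to the inner product determined by $\langle k_{A_r}(\cdot,\mu),k_{A_r}(\cdot,\lambda)\rangle=k_{A_r}(\lambda,\mu)$. A function $\phi:A_r\to\mathbb{C}$ is a multiplier of $\mathscr{H}^2(A_r)$ if $M_\phi f=\phi f$ defines a bounded operator on $\mathscr{H}^2(A_r)$, and then $\|\phi\|_{\mathrm{Mult}(\mathscr{H}^2(A_r))}=\|M_\phi\|$. Let $\mathcal{F}_r$ be the class of all bounded operators $T$ on complex Hilbert spaces such that $\sigma(T)\subset A_r$ and $$r^2T^{-1}(T^{-1})^*+TT^*\le r^2+1.$$ For $\phi$ holomorphic on $A_r$ with Laurent series $\phi(z)=\sum_{n\in\mathbb{Z}}a_nz^n$ and $T\in\mathcal{F}_r$,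 put $\phi(T)=\sum_{n\in\mathbb{Z}}a_nT^n$; this series converges unconditionally in the operator norm when $\phi$ is bounded. Then every bounded holomorphic function $\phi$ on $A_r$ is a multiplier of $\mathscr{H}^2(A_r)$, and $$\sup_{T\in\mathcal{F}_r}\|\phi(T)\|=\|\phi\|_{\mathrm{Mult}(\mathscr{H}^2(A_r))}\le\sqrt2\,\sup_{z\in A_r}|\phi(z)|.$$ For each $r\in(0,1)$ the constant $\sqrt2$ is the best possible: if $C\in\mathbb{R}$ is such that $\|\phi\|_{\mathrm{Mult}(\mathscr{H}^2(A_r))}\le C\sup_{z\in A_r}|\phi(z)|$ for every bounded holomorphic $\phi$ on $A_r$, then $C\ge\sqrt2$. -/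

import Mathlib

open ComplexConjugate

universe u

/-- The open annulus `A_r = {z : r < |z| < 1}`. -/
def annulus (r : ℝ) : Set ℂ := {z | r < ‖z‖ ∧ ‖z‖ < 1}

/-- The reproducing kernel `k(z, w) = (1 - r²) / ((1 - z w̄) (1 - r² / (z w̄)))`. -/
noncomputable def annulusKernel (r : ℝ) (z w : ℂ) : ℂ :=
  (1 - (r : ℂ) ^ 2) / ((1 - z * conj w) * (1 - (r : ℂ) ^ 2 / (z * conj w)))

/-- The kernel on `A_r`, its scalar values being regarded as multiplication operators on `ℂ`
(the form in which `RKHS` takes a kernel). -/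
noncomputable def annulusKernelMatrix (r : ℝ) :
    Matrix (annulus r) (annulus r) (ℂ →L[ℂ] ℂ) :=
  Matrix.of fun z w => annulusKernel r z w • ContinuousLinearMap.id ℂ ℂ

theorem hasSum_annulusKernel {r : ℝ} (h0 : 0 < r) (h1 : r < 1) (z w : annulus r) :
    HasSum (fun n : ℕ => (z : ℂ) ^ n * conj ((w : ℂ) ^ n)
      + ((r : ℂ) / z) ^ (n + 1) * conj (((r : ℂ) / w) ^ (n + 1))) (annulusKernel r z w) := by
  obtain ⟨z, hz1, hz2⟩ := z
  obtain ⟨w, hw1, hw2⟩ := w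
  have hz0 : z ≠ 0 := norm_pos_iff.1 (h0.trans hz1)
  have hw0 : conj w ≠ 0 := by
    simpa using norm_pos_iff.1 (h0.trans hw1)
  have hq : ‖z * conj w‖ < 1 := by
    rw [norm_mul, RCLike.norm_conj]
    nlinarith [norm_nonneg z, norm_nonneg w]
  have hs : ‖(r : ℂ) ^ 2 / (z * conj w)‖ < 1 := by
    rw [norm_div, norm_mul, RCLike.norm_conj, norm_pow, Complex.norm_real, Real.norm_eq_abs,
      abs_of_pos h0, div_lt_one (mul_pos (h0.trans hz1) (h0.trans hw1))]
    nlinarith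
  have hne : ∀ x : ℂ, ‖x‖ < 1 → 1 - x ≠ 0 := by
    intro x hx h
    have : x = 1 := (sub_eq_zero.1 h).symm
    simp [this] at hx
  have hA := hasSum_geometric_of_norm_lt_one hq
  have hB := (hasSum_geometric_of_norm_lt_one hs).mul_left ((r : ℂ) ^ 2 / (z * conj w))
  have hq' := hne _ hq
  have hs' := hne _ hs
  have hsum : annulusKernel r z w = (1 - z * conj w)⁻¹
      + (r : ℂ) ^ 2 / (z * conj w) * (1 - (r : ℂ) ^ 2 / (z * conj w))⁻¹ := by
    have hqs : z * conj w * ((r : ℂ) ^ 2 / (z * conj w)) = (r : ℂ) ^ 2 := by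
      field_simp
    unfold annulusKernel
    rw [← hqs]
    generalize z * conj w = q at *
    rw [hqs]
    generalize (r : ℂ) ^ 2 / q = s at *
    rw [← hqs]
    field_simp
    ring
  rw [show annulusKernel r _ _ = _ from hsum]
  refine (hA.add hB).congr_fun ?_
  intro n
  simp only [map_pow, map_div₀, Complex.conj_ofReal]
  rw [← mul_pow, ← mul_pow, ← pow_succ']
  congr 2
  field_simp

theorem posSemidef_annulusKernelMatrix {r : ℝ} (h0 : 0 < r) (h1 : r < 1) :
    (annulusKernelMatrix r).PosSemidef := by
  have htfae := (RKHS.posSemidef_tfae (K := annulusKernelMatrix r)).out 0 2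
  refine htfae.2 ⟨?_, ?_⟩
  · ext1 z w
    simp only [Matrix.conjTranspose_apply, annulusKernelMatrix, Matrix.of_apply, star_smul]
    congr 1
    · simp [annulusKernel, mul_comm]
    · exact star_one (ℂ →L[ℂ] ℂ)
  · intro v
    have key : HasSum (fun n : ℕ => v.sum fun x a => v.sum fun y b =>
        conj (((y : ℂ) ^ n * conj ((x : ℂ) ^ n)
          + ((r : ℂ) / y) ^ (n + 1) * conj (((r : ℂ) / x) ^ (n + 1))) * a) * b)
        (v.sum fun x a => v.sum fun y b => inner ℂ (annulusKernelMatrix r y x a) b) := by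
      refine hasSum_sum fun x _ => hasSum_sum fun y _ => ?_
      have h := hasSum_annulusKernel h0 h1 y x
      have h2 := ((Complex.hasSum_conj'.2 (h.mul_right (v x))).mul_right (v y))
      convert! h2 using 1
      simp [annulusKernelMatrix, mul_comm]
    have hre := Complex.hasSum_re key
    refine hre.nonneg fun n => ?_
    have h : (v.sum fun x a => v.sum fun y b =>
        conj (((y : ℂ) ^ n * conj ((x : ℂ) ^ n)
          + ((r : ℂ) / y) ^ (n + 1) * conj (((r : ℂ) / x) ^ (n + 1))) * a) * b)
        = ((Complex.normSq (v.sum fun x a => conj ((x : ℂ) ^ n) * a)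
          + Complex.normSq (v.sum fun x a => conj (((r : ℂ) / x) ^ (n + 1)) * a) : ℝ) : ℂ) := by
      rw [Complex.ofReal_add, Complex.normSq_eq_conj_mul_self, Complex.normSq_eq_conj_mul_self]
      simp only [Finsupp.sum, map_sum, Finset.sum_mul_sum, ← Finset.sum_add_distrib]
      refine Finset.sum_congr rfl fun x _ => Finset.sum_congr rfl fun y _ => ?_
      simp only [map_mul, map_add, Complex.conj_conj]
      ring
    rw [h, Complex.ofReal_re]
    exact add_nonneg (Complex.normSq_nonneg _) (Complex.normSq_nonneg _)

instance instFactPosSemidefAnnulusKernelMatrix (r : Set.Ioo (0 : ℝ) 1) :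
    Fact (annulusKernelMatrix (r : ℝ)).PosSemidef :=
  ⟨posSemidef_annulusKernelMatrix r.2.1 r.2.2⟩

/-- The Hilbert function space on `A_r` with reproducing kernel `annulusKernel r`: the completion
of the linear span of the kernel functions. -/
abbrev AnnulusSpace (r : Set.Ioo (0 : ℝ) 1) : Type :=
  RKHS.OfKernel (annulusKernelMatrix (r : ℝ))

section Multipliers

variable {X : Type*} (H : Type*) [NormedAddCommGroup H] [InnerProductSpace ℂ H] [RKHS ℂ H X ℂ]

/-- `φ` is a multiplier of `H`: pointwise multiplication by `φ` is a bounded operator on `H`. -/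
def IsMultiplier (φ : X → ℂ) : Prop :=
  ∃ M : H →L[ℂ] H, ∀ (f : H) (x : X), M f x = φ x * f x

open Classical in
/-- The multiplication operator `M_φ` of a multiplier (and `0` if `φ` is not a multiplier). -/
noncomputable def multOp (φ : X → ℂ) : H →L[ℂ] H :=
  if h : IsMultiplier H φ then h.choose else 0

/-- The multiplier norm `‖φ‖_{Mult(H)} = ‖M_φ‖`. -/
noncomputable def multNorm (φ : X → ℂ) : ℝ := ‖multOp H φ‖

end Multipliers

/-- `φ ∈ H^∞(A_r)`: `φ` is holomorphic and bounded on `A_r`. -/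
def MemHInfty (r : ℝ) (φ : ℂ → ℂ) : Prop :=
  DifferentiableOn ℂ φ (annulus r) ∧ ∃ C : ℝ, ∀ z ∈ annulus r, ‖φ z‖ ≤ C

/-- The supremum norm over `A_r`. -/
noncomputable def supNorm (r : ℝ) (φ : ℂ → ℂ) : ℝ := ⨆ z : annulus r, ‖φ z‖

/-- The `n`-th coefficient of the Laurent series on `A_r` of a holomorphic function `φ`. The
circle of radius `√r` lies in `A_r` when `0 < r < 1`. -/
noncomputable def laurentCoeff (r : ℝ) (φ : ℂ → ℂ) (n : ℤ) : ℂ :=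
  (2 * (Real.pi : ℂ) * Complex.I)⁻¹ * ∮ z in C(0, Real.sqrt r), z ^ (-n - 1) * φ z

section Operators

variable {H : Type u} [NormedAddCommGroup H] [InnerProductSpace ℂ H]

/-- Integer powers of an invertible operator. -/
noncomputable def opZPow (T : H →L[ℂ] H) : ℤ → (H →L[ℂ] H)
  | Int.ofNat n => T ^ n
  | Int.negSucc n => Ring.inverse T ^ (n + 1)

/-- The terms `a_n T ^ n` of the Laurent series defining `φ(T)`. -/
noncomputable def laurentTerm (r : ℝ) (φ : ℂ → ℂ) (T : H →L[ℂ] H) (n : ℤ) : H →L[ℂ] H :=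
  laurentCoeff r φ n • opZPow T n

/-- The operator `φ(T) = ∑_{n ∈ ℤ} a_n T ^ n`, where `φ(z) = ∑_{n ∈ ℤ} a_n z ^ n` on `A_r`. -/
noncomputable def funcCalc (r : ℝ) (φ : ℂ → ℂ) (T : H →L[ℂ] H) : H →L[ℂ] H :=
  ∑' n : ℤ, laurentTerm r φ T n

/-- The class `F_r` on `H`: `σ(T) ⊆ A_r` and `r² T⁻¹ (T⁻¹)* + T T* ≤ r² + 1`. -/
def classF (r : ℝ) (H : Type u) [NormedAddCommGroup H] [InnerProductSpace ℂ H]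
    [CompleteSpace H] : Set (H →L[ℂ] H) :=
  {T | spectrum ℂ T ⊆ annulus r ∧
    ((r : ℂ) ^ 2) • (Ring.inverse T * ContinuousLinearMap.adjoint (Ring.inverse T))
      + T * ContinuousLinearMap.adjoint T ≤ ((r : ℂ) ^ 2 + 1) • (1 : H →L[ℂ] H)}

end Operators

/-- The set of all `‖φ(T)‖`, with `T` in the class `F_r` on an arbitrary complex Hilbert space. -/
def calcNorms (r : ℝ) (φ : ℂ → ℂ) : Set ℝ :=
  {c | ∃ (H : Type u) (_ : NormedAddCommGroup H) (_ : InnerProductSpace ℂ H)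
    (_ : CompleteSpace H), ∃ T ∈ classF r H, c = ‖funcCalc r φ T‖}

open MeasureTheory AddCircle Filter Topology ContinuousLinearMap

/-! Let w_n = `monomialWeight r n`, equal to 1 for n ≥ 0 and to r^|n| for n < 0. The kernel is the
sum of e_n(z) conj(e_n(w)) with e_n = w_n z^n, and the e_n form an orthonormal basis of
`AnnulusSpace r`. So f = Σ a_n z^n has squared norm Σ |a_n|²/w_n². The sum of the mean squares of f
on the circles |z| = 1 and |z| = r is Σ |a_n|² (1 + r^(2n)), and w_n² (1 + r^(2n)) = 1 + r^(2|n|)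
lies between 1 and 2. Multiplication by φ enlarges the boundary norm at most by the factor sup |φ|,
which gives the constant √2 (`exists_mem_of_norm_le_mul`). It is sharp: z^N + (r/z)^N has supremum
at most 1 + r^N, but sends e_0 to e_N + e_(-N), of norm √2.

For T in F_r write the defect r² + 1 - r² T⁻¹(T⁻¹)* - TT* as D*D. The sequence w_n D (T*)^n h has
square sum (1 - r²)‖h‖² by telescoping (`hasSum_defect`), and sending h to this sequence intertwines
φ(T)* with the matrix of M_φ* acting on H-valued sequences. Hence ‖φ(T)‖ ≤ ‖M_φ‖
(`norm_funcCalc_le`).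

Conversely, M_z is the bilateral shift with weights 1 on n ≥ 0 and r on n < 0. Its spectrum is the
closed annulus, so it is not in F_r; with the weights t and r/t, where √r < t < 1, the shift is in
F_r (`twoValueUnit_mem_classF`). The matrix entries of φ of this shift tend to those of M_φ as t →
1, so ‖M_φ‖ is at most every upper bound of the ‖φ(T)‖ (`multNorm_le_of_mem_upperBounds`). -/

/-! ### Fourier series on circles and Laurent series -/

instance fact_two_pi_pos : Fact (0 < 2 * Real.pi) := ⟨Real.two_pi_pos⟩

theorem isOpen_annulus (r : ℝ) : IsOpen (annulus r) :=
  (isOpen_lt continuous_const continuous_norm).inter (isOpen_lt continuous_norm continuous_const)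

theorem norm_ofReal_mul_toCircle {ρ : ℝ} (hρ : 0 < ρ) (x : AddCircle (2 * Real.pi)) :
    ‖(ρ : ℂ) * (toCircle x : ℂ)‖ = ρ := by
  rw [norm_mul, Circle.norm_coe, mul_one, Complex.norm_real, Real.norm_of_nonneg hρ.le]

theorem ofReal_mul_toCircle_mem_annulus {r ρ : ℝ} (h0 : 0 < r) (hr : r < ρ) (h1 : ρ < 1)
    (x : AddCircle (2 * Real.pi)) : (ρ : ℂ) * (toCircle x : ℂ) ∈ annulus r := by
  simp only [annulus, Set.mem_ofPred_eq, norm_ofReal_mul_toCircle (h0.trans hr) x]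
  exact ⟨hr, h1⟩

theorem exists_toCircle_eq (z : ℂ) :
    ∃ x : AddCircle (2 * Real.pi), z = (‖z‖ : ℂ) * (toCircle x : ℂ) := by
  refine ⟨(z.arg : AddCircle (2 * Real.pi)), ?_⟩
  rw [toCircle_apply_mk, Circle.coe_exp]
  have : (2 * Real.pi / (2 * Real.pi) : ℝ) = 1 := div_self Real.two_pi_pos.ne'
  rw [this, one_mul, Complex.norm_mul_exp_arg_mul_I]

theorem toCircle_coe_two_pi (θ : ℝ) :
    (toCircle (θ : AddCircle (2 * Real.pi)) : ℂ) = Complex.exp (θ * Complex.I) := by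
  rw [toCircle_apply_mk, Circle.coe_exp]
  have : (2 * Real.pi / (2 * Real.pi) : ℝ) = 1 := div_self Real.two_pi_pos.ne'
  rw [this, one_mul]

theorem fourier_eq_toCircle_zpow (n : ℤ) (x : AddCircle (2 * Real.pi)) :
    fourier n x = (toCircle x : ℂ) ^ n := by
  rw [fourier_apply, toCircle_zsmul]
  simp

theorem fourierCoeff_circle_eq (f : ℂ → ℂ) {ρ : ℝ} (hρ : 0 < ρ) (n : ℤ) :
    fourierCoeff (fun x : AddCircle (2 * Real.pi) => f ((ρ : ℂ) * (toCircle x : ℂ))) n =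
      (ρ : ℂ) ^ n * ((2 * (Real.pi : ℂ) * Complex.I)⁻¹ *
        ∮ z in C(0, ρ), z ^ (-n - 1) * f z) := by
  have hρ' : (ρ : ℂ) ≠ 0 := by exact_mod_cast hρ.ne'
  rw [fourierCoeff_eq_intervalIntegral _ n 0, circleIntegral, zero_add, mul_left_comm,
    ← intervalIntegral.integral_const_mul]
  have hint : ∀ θ : ℝ, (ρ : ℂ) ^ n * (deriv (circleMap 0 ρ) θ • (circleMap 0 ρ θ ^ (-n - 1) *
      f (circleMap 0 ρ θ))) = Complex.I * (fourier (-n) (θ : AddCircle (2 * Real.pi)) •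
        f ((ρ : ℂ) * (toCircle (θ : AddCircle (2 * Real.pi)) : ℂ))) := by
    intro θ
    rw [fourier_eq_toCircle_zpow, toCircle_coe_two_pi, deriv_circleMap]
    have hz : circleMap 0 ρ θ = (ρ : ℂ) * Complex.exp (θ * Complex.I) := by simp [circleMap]
    have he := Complex.exp_ne_zero (θ * Complex.I)
    rw [hz]
    simp only [smul_eq_mul]
    rw [zpow_sub_one₀ (mul_ne_zero hρ' he), mul_zpow, zpow_neg (ρ : ℂ)]
    field_simp
  simp_rw [hint]
  rw [intervalIntegral.integral_const_mul, ← mul_assoc, Complex.real_smul]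
  congr 1
  push_cast
  field_simp

theorem circleIntegral_zpow_mul_eq {r : ℝ} (h0 : 0 < r) {f : ℂ → ℂ}
    (hf : DifferentiableOn ℂ f (annulus r)) (n : ℤ) {ρ ρ' : ℝ} (hr : r < ρ) (hle : ρ ≤ ρ')
    (h1 : ρ' < 1) :
    (∮ z in C(0, ρ'), z ^ (-n - 1) * f z) = ∮ z in C(0, ρ), z ^ (-n - 1) * f z := by
  have hd : DifferentiableOn ℂ (fun z => z ^ (-n - 1) * f z) (annulus r) := by
    intro z hz
    have hz0 : z ≠ 0 := norm_pos_iff.1 (h0.trans hz.1)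
    exact ((differentiableAt_zpow.2 (Or.inl hz0)).differentiableWithinAt).mul (hf z hz)
  refine Complex.circleIntegral_eq_of_differentiable_on_annulus_off_countable (h0.trans hr) hle
    Set.countable_empty (hd.continuousOn.mono ?_) ?_
  · intro z hz
    simp only [Set.mem_sdiff, Metric.mem_closedBall, dist_zero_right, Metric.mem_ball, not_lt] at hz
    exact ⟨hr.trans_le hz.2, hz.1.trans_lt h1⟩
  · intro z hz
    simp only [Set.mem_sdiff, Metric.mem_closedBall, dist_zero_right, Metric.mem_ball, not_le,
      Set.mem_empty_iff_false, not_false_eq_true, and_true] at hz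
    exact hd.differentiableAt ((isOpen_annulus r).mem_nhds ⟨hr.trans hz.2, hz.1.trans h1⟩)

/-- By Cauchy's theorem the coefficient integral does not depend on the radius, so the circle of
radius √r in `laurentCoeff` can be traded for any other. This is what allows radii to tend to either
boundary circle later. -/
theorem fourierCoeff_circle_eq_laurentCoeff {r : ℝ} (h0 : 0 < r) (h1 : r < 1) {f : ℂ → ℂ}
    (hf : DifferentiableOn ℂ f (annulus r)) {ρ : ℝ} (hr : r < ρ) (hρ : ρ < 1) (n : ℤ) :
    fourierCoeff (fun x : AddCircle (2 * Real.pi) => f ((ρ : ℂ) * (toCircle x : ℂ))) n =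
      (ρ : ℂ) ^ n * laurentCoeff r f n := by
  have hs1 : r < √r := by
    rw [Real.lt_sqrt h0.le]; nlinarith
  have hs2 : √r < 1 := by
    rw [Real.sqrt_lt' one_pos]; simpa using h1
  rw [fourierCoeff_circle_eq f (h0.trans hr) n, laurentCoeff]
  congr 2
  rcases le_total ρ √r with h | h
  · exact (circleIntegral_zpow_mul_eq h0 hf n hr h hs2).symm
  · exact circleIntegral_zpow_mul_eq h0 hf n hs1 h hρ

theorem continuous_comp_circle {r : ℝ} (h0 : 0 < r) {f : ℂ → ℂ}
    (hf : ContinuousOn f (annulus r)) {ρ : ℝ} (hr : r < ρ) (hρ : ρ < 1) :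
    Continuous fun x : AddCircle (2 * Real.pi) => f ((ρ : ℂ) * (toCircle x : ℂ)) := by
  refine hf.comp_continuous ?_ fun x => ofReal_mul_toCircle_mem_annulus h0 hr hρ x
  exact continuous_const.mul (continuous_subtype_val.comp continuous_toCircle)

/-- The mean value of `‖f‖²` over the circle of radius `ρ`. -/
noncomputable def circleMeanSq (f : ℂ → ℂ) (ρ : ℝ) : ℝ :=
  ∫ x : AddCircle (2 * Real.pi), ‖f ((ρ : ℂ) * (toCircle x : ℂ))‖ ^ 2 ∂haarAddCircle

/-- Parseval's identity on the circle of radius `ρ`. -/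
theorem hasSum_laurentCoeff_sq {r : ℝ} (h0 : 0 < r) (h1 : r < 1) {f : ℂ → ℂ}
    (hf : DifferentiableOn ℂ f (annulus r)) {ρ : ℝ} (hr : r < ρ) (hρ : ρ < 1) :
    HasSum (fun n : ℤ => (ρ ^ n * ‖laurentCoeff r f n‖) ^ 2) (circleMeanSq f ρ) := by
  let F : C(AddCircle (2 * Real.pi), ℂ) := ⟨_, continuous_comp_circle h0 hf.continuousOn hr hρ⟩
  have h := hasSum_sq_fourierCoeff (ContinuousMap.toLp (E := ℂ) 2 haarAddCircle ℂ F)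
  have hint : (∫ t, ‖(ContinuousMap.toLp (E := ℂ) 2 haarAddCircle ℂ F) t‖ ^ 2 ∂haarAddCircle)
      = circleMeanSq f ρ := by
    refine integral_congr_ae ?_
    filter_upwards [ContinuousMap.coeFn_toLp (p := 2) (𝕜 := ℂ) haarAddCircle F] with x hx
    rw [hx]; rfl
  rw [hint] at h
  refine h.congr_fun fun n => ?_
  rw [fourierCoeff_toLp]
  change _ = ‖fourierCoeff (fun x => f ((ρ : ℂ) * (toCircle x : ℂ))) n‖ ^ 2
  rw [fourierCoeff_circle_eq_laurentCoeff h0 h1 hf hr hρ, norm_mul, norm_zpow, Complex.norm_real,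
    Real.norm_of_nonneg (h0.trans hr).le]

theorem circleMeanSq_mul_le {r : ℝ} (h0 : 0 < r) {f g : ℂ → ℂ}
    (hf : ContinuousOn f (annulus r)) (hg : ContinuousOn g (annulus r)) {S : ℝ}
    (hS : ∀ z ∈ annulus r, ‖g z‖ ≤ S * ‖f z‖) {ρ : ℝ} (hr : r < ρ) (hρ : ρ < 1) :
    circleMeanSq g ρ ≤ S ^ 2 * circleMeanSq f ρ := by
  unfold circleMeanSq
  rw [← integral_const_mul]
  have hF := continuous_comp_circle h0 hf hr hρ
  have hG := continuous_comp_circle h0 hg hr hρ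
  have hi : ∀ u : AddCircle (2 * Real.pi) → ℝ, Continuous u → Integrable u haarAddCircle :=
    fun u hu => hu.integrable_of_hasCompactSupport (HasCompactSupport.of_compactSpace u)
  refine integral_mono (hi _ (hG.norm.pow 2)) (hi _ ((hF.norm.pow 2).const_mul _)) fun x => ?_
  dsimp only
  rw [← mul_pow]
  exact pow_le_pow_left₀ (norm_nonneg _) (hS _ (ofReal_mul_toCircle_mem_annulus h0 hr hρ x)) 2

theorem norm_laurentCoeff_le {r : ℝ} (h0 : 0 < r) (h1 : r < 1) {f : ℂ → ℂ}
    (hf : DifferentiableOn ℂ f (annulus r)) {ρ : ℝ} (hr : r < ρ) (hρ : ρ < 1) {C : ℝ}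
    (hC : ∀ z, ‖z‖ = ρ → ‖f z‖ ≤ C) (n : ℤ) : ρ ^ n * ‖laurentCoeff r f n‖ ≤ C := by
  have h := fourierCoeff_circle_eq_laurentCoeff h0 h1 hf hr hρ n
  have h2 := congrArg norm h
  rw [norm_mul, norm_zpow, Complex.norm_real, Real.norm_of_nonneg (h0.trans hr).le] at h2
  rw [← h2, fourierCoeff]
  refine (norm_integral_le_of_norm_le_const (C := C) (Eventually.of_forall fun x => ?_)).trans ?_
  · rw [norm_smul, fourier_eq_toCircle_zpow, norm_zpow, Circle.norm_coe, one_zpow, one_mul]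
    exact hC _ (norm_ofReal_mul_toCircle (h0.trans hr) x)
  · simp

theorem exists_norm_le_on_circle {r : ℝ} {f : ℂ → ℂ}
    (hf : ContinuousOn f (annulus r)) {ρ : ℝ} (hr : r < ρ) (hρ : ρ < 1) :
    ∃ C, ∀ z, ‖z‖ = ρ → ‖f z‖ ≤ C := by
  obtain ⟨C, hC⟩ := (isCompact_sphere (0 : ℂ) ρ).exists_bound_of_continuousOn
    (hf.mono fun z hz => by
      rw [mem_sphere_zero_iff_norm] at hz
      exact ⟨hz ▸ hr, hz ▸ hρ⟩)
  exact ⟨C, fun z hz => hC z (by simpa using hz)⟩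

/-- A bilateral sequence dominated by geometric sequences of ratio less than one is summable. -/
theorem summable_int_of_le_geometric {E : Type*} [NormedAddCommGroup E] [CompleteSpace E]
    {u : ℤ → E} {C a b : ℝ} (ha : 0 ≤ a) (ha1 : a < 1) (hb : 0 ≤ b) (hb1 : b < 1)
    (hpos : ∀ n : ℕ, ‖u n‖ ≤ C * a ^ n) (hneg : ∀ n : ℕ, ‖u (-(n : ℤ))‖ ≤ C * b ^ n) :
    Summable u := by
  refine Summable.of_norm (Summable.of_nat_of_neg ?_ ?_)
  · exact Summable.of_nonneg_of_le (fun _ => norm_nonneg _) hpos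
      ((summable_geometric_of_lt_one ha ha1).mul_left C)
  · exact Summable.of_nonneg_of_le (fun _ => norm_nonneg _) hneg
      ((summable_geometric_of_lt_one hb hb1).mul_left C)

/-- The Cauchy estimates on one circle outside z and one inside z dominate the two halves of the
series by geometric series. -/
theorem summable_laurentCoeff {r : ℝ} (h0 : 0 < r) (h1 : r < 1) {f : ℂ → ℂ}
    (hf : DifferentiableOn ℂ f (annulus r)) {z : ℂ} (hz : z ∈ annulus r) :
    Summable fun n : ℤ => laurentCoeff r f n * z ^ n := by
  obtain ⟨ρ, hρ1, hρ2⟩ := exists_between hz.1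
  obtain ⟨ρ', hρ1', hρ2'⟩ := exists_between hz.2
  obtain ⟨C, hC⟩ := exists_norm_le_on_circle hf.continuousOn hρ1 (hρ2.trans hz.2)
  obtain ⟨C', hC'⟩ := exists_norm_le_on_circle hf.continuousOn (hz.1.trans hρ1') hρ2'
  have hb := norm_laurentCoeff_le h0 h1 hf hρ1 (hρ2.trans hz.2) hC
  have hb' := norm_laurentCoeff_le h0 h1 hf (hz.1.trans hρ1') hρ2' hC'
  have hz0 : 0 < ‖z‖ := h0.trans hz.1
  have hρ0 : 0 < ρ := h0.trans hρ1
  have hρ0' : 0 < ρ' := hz0.trans hρ1'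
  refine summable_int_of_le_geometric (C := max C C') (a := ‖z‖ / ρ') (b := ρ / ‖z‖) (by positivity)
    ((div_lt_one hρ0').2 hρ1') (by positivity) ((div_lt_one hz0).2 hρ2) (fun n => ?_) fun n => ?_
  · rw [norm_mul, norm_zpow]
    have := hb' n
    simp only [zpow_natCast] at this ⊢
    rw [div_pow, mul_div_assoc', le_div_iff₀ (by positivity)]
    calc _ = ρ' ^ n * ‖laurentCoeff r f n‖ * ‖z‖ ^ n := by ring
      _ ≤ max C C' * ‖z‖ ^ n := by gcongr; exact this.trans (le_max_right _ _)
  · rw [norm_mul, norm_zpow]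
    have := hb (-n)
    simp only [zpow_neg, zpow_natCast] at this ⊢
    rw [div_pow, mul_div_assoc', ← div_eq_mul_inv]
    gcongr
    rw [inv_mul_le_iff₀ (by positivity)] at this
    calc _ ≤ ρ ^ n * C := this
      _ ≤ max C C' * ρ ^ n := by rw [mul_comm]; gcongr; exact le_max_left _ _

/-- Laurent's theorem on the annulus. -/
theorem hasSum_laurentCoeff {r : ℝ} (h0 : 0 < r) (h1 : r < 1) {f : ℂ → ℂ}
    (hf : DifferentiableOn ℂ f (annulus r)) {z : ℂ} (hz : z ∈ annulus r) :
    HasSum (fun n : ℤ => laurentCoeff r f n * z ^ n) (f z) := by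
  let F : C(AddCircle (2 * Real.pi), ℂ) :=
    ⟨_, continuous_comp_circle h0 hf.continuousOn hz.1 hz.2⟩
  obtain ⟨x, hx⟩ := exists_toCircle_eq z
  have hF : ∀ n, fourierCoeff F n = (‖z‖ : ℂ) ^ n * laurentCoeff r f n := fun n =>
    fourierCoeff_circle_eq_laurentCoeff h0 h1 hf hz.1 hz.2 n
  have hsum : Summable (fourierCoeff F) := by
    refine Summable.of_norm ((summable_laurentCoeff h0 h1 hf hz).norm.congr fun n => ?_)
    rw [hF]
    simp [mul_comm]
  -- On the circle through z the Fourier coefficients are absolutely summable, so the Fourier series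
  -- of the continuous function `F` converges to it at every point.
  have h := has_pointwise_sum_fourier_series_of_summable hsum x
  have hFx : F x = f z := by rw [hx]; simp [F]
  rw [hFx] at h
  refine h.congr_fun fun n => ?_
  rw [hF, fourier_eq_toCircle_zpow]
  conv_lhs => rw [hx, mul_zpow]
  simp only [smul_eq_mul]
  ring

/-- Summable coefficients make the series converge in the supremum norm, where the n-th Fourier
coefficient is a continuous functional (`L` below) and can be taken term by term. -/
theorem fourierCoeff_of_hasSum {c : ℤ → ℂ} {F : AddCircle (2 * Real.pi) → ℂ} (hc : Summable c)
    (hF : ∀ x, HasSum (fun n => c n * (toCircle x : ℂ) ^ n) (F x)) (n : ℤ) :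
    fourierCoeff F n = c n := by
  have hs : Summable fun n => c n • (fourier n : C(AddCircle (2 * Real.pi), ℂ)) := by
    refine Summable.of_norm ?_
    simpa [norm_smul, fourier_norm] using hc.norm
  obtain ⟨G, hG⟩ := hs
  have hGF : ∀ x, G x = F x := fun x => by
    have h := (ContinuousMap.evalCLM ℂ x).hasSum hG
    refine h.unique ((hF x).congr_fun fun n => ?_)
    simp [← fourier_eq_toCircle_zpow]
  have hFG : F = G := funext fun x => (hGF x).symm
  let L : C(AddCircle (2 * Real.pi), ℂ) →L[ℂ] ℂ :=
    (innerSL ℂ (fourierBasis (T := 2 * Real.pi) n)) ∘L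
      (ContinuousMap.toLp (E := ℂ) 2 haarAddCircle ℂ)
  have hL : ∀ G : C(AddCircle (2 * Real.pi), ℂ), L G = fourierCoeff G n := by
    intro G
    rw [← fourierCoeff_toLp, ← fourierBasis_repr, HilbertBasis.repr_apply_apply]
    rfl
  rw [hFG, ← hL]
  have h := L.hasSum hG
  refine h.unique ?_
  have h2 : ∀ m, L (c m • fourier m) = if m = n then c n else 0 := by
    intro m
    rw [map_smul, hL, fourierCoeff_fourier]
    by_cases hmn : m = n
    · simp [hmn]
    · simp [hmn, Ne.symm hmn]
  simp_rw [h2]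
  exact hasSum_ite_eq n (c n)

theorem laurentCoeff_of_hasSum {r : ℝ} (h0 : 0 < r) (h1 : r < 1) {f : ℂ → ℂ} {c : ℤ → ℂ}
    (hf : ∀ z ∈ annulus r, HasSum (fun n : ℤ => c n * z ^ n) (f z)) (n : ℤ) :
    laurentCoeff r f n = c n := by
  have hs1 : r < √r := by
    rw [Real.lt_sqrt h0.le]; nlinarith
  have hs2 : √r < 1 := by
    rw [Real.sqrt_lt' one_pos]; simpa using h1
  have hs0 : 0 < √r := h0.trans hs1
  have h := fourierCoeff_circle_eq f hs0 n
  have hne : (√r : ℂ) ^ n ≠ 0 := zpow_ne_zero _ (by exact_mod_cast hs0.ne')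
  have hF : ∀ x : AddCircle (2 * Real.pi),
      HasSum (fun n => c n * (√r : ℂ) ^ n * (toCircle x : ℂ) ^ n) (f (√r * toCircle x)) := by
    intro x
    refine (hf _ (ofReal_mul_toCircle_mem_annulus h0 hs1 hs2 x)).congr_fun fun n => ?_
    rw [mul_zpow, mul_assoc]
  have hc : Summable fun n => c n * (√r : ℂ) ^ n := by
    -- At `x = 0` the point of the unit circle is 1, so the terms are the coefficients themselves.
    simpa using (hF 0).summable
  rw [fourierCoeff_of_hasSum hc hF] at h
  rw [laurentCoeff]
  rw [mul_comm] at h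
  exact (mul_left_cancel₀ hne h).symm

theorem differentiableOn_of_hasSum_zpow {r : ℝ} (h0 : 0 < r) {f : ℂ → ℂ} {c : ℤ → ℂ}
    (hf : ∀ z ∈ annulus r, HasSum (fun n : ℤ => c n * z ^ n) (f z)) :
    DifferentiableOn ℂ f (annulus r) := by
  intro z hz
  obtain ⟨ρ, hρ1, hρ2⟩ := exists_between hz.1
  obtain ⟨ρ', hρ1', hρ2'⟩ := exists_between hz.2
  have hz0 : 0 < ‖z‖ := h0.trans hz.1
  have hρ0 : 0 < ρ := h0.trans hρ1
  have hρ0' : 0 < ρ' := hz0.trans hρ1'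
  let U : Set ℂ := {w | ρ < ‖w‖ ∧ ‖w‖ < ρ'}
  have hU : IsOpen U :=
    (isOpen_lt continuous_const continuous_norm).inter (isOpen_lt continuous_norm continuous_const)
  have hsub : U ⊆ annulus r := fun w hw => ⟨hρ1.trans hw.1, hw.2.trans hρ2'⟩
  have hm : ∀ t : ℝ, r < t → t < 1 → Summable fun n => ‖c n‖ * t ^ n := by
    intro t ht ht1
    have ht0 : 0 < t := h0.trans ht
    have := (hf (t : ℂ) ⟨by simpa [abs_of_pos ht0] using ht,
      by simpa [abs_of_pos ht0] using ht1⟩).summable.norm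
    simpa [abs_of_pos ht0] using this
  -- On `U` the power ‖w‖^n is at most ρ'^n for n ≥ 0 and at most ρ^n for n ≤ 0, so the sum of the
  -- two is a majorant for every n.
  have hu := (hm ρ hρ1 (hρ2.trans hz.2)).add (hm ρ' (hz.1.trans hρ1') hρ2')
  have hd := Complex.differentiableOn_tsum_of_summable_norm (F := fun n w => c n * w ^ n) hu
    (fun n w hw => ((differentiableAt_zpow.2 (Or.inl (norm_pos_iff.1 (hρ0.trans hw.1)))).const_mul
      _).differentiableWithinAt) hU (fun n w hw => by
      rw [norm_mul, norm_zpow, ← mul_add]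
      gcongr
      have hw0 : 0 < ‖w‖ := hρ0.trans hw.1
      rcases le_total 0 n with hn | hn
      · exact (zpow_le_zpow_left₀ hn hw0.le hw.2.le).trans (le_add_of_nonneg_left (by positivity))
      · refine le_trans ?_ (le_add_of_nonneg_right (by positivity))
        obtain ⟨m, rfl⟩ : ∃ m : ℤ, n = -m := ⟨-n, by simp⟩
        rw [zpow_neg, zpow_neg]
        exact inv_anti₀ (zpow_pos hρ0 _) (zpow_le_zpow_left₀ (by omega) hρ0.le hw.1.le))
  have hd' : DifferentiableOn ℂ f U := hd.congr fun w hw => ((hf w (hsub hw)).tsum_eq).symm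
  exact (hd'.differentiableAt (hU.mem_nhds ⟨hρ2, hρ1'⟩)).differentiableWithinAt

/-! ### The orthonormal basis of normalized monomials -/

theorem denseRange_linearCombination {X E : Type*} [NormedAddCommGroup E] [InnerProductSpace ℂ E]
    {v : X → E} (hv : (Submodule.span ℂ (Set.range v)).topologicalClosure = ⊤) :
    DenseRange (Finsupp.linearCombination ℂ v) := by
  rw [← Finsupp.range_linearCombination, ← Submodule.dense_iff_topologicalClosure_eq_top,
    LinearMap.coe_range] at hv
  exact hv

/-- Two families with dense spans and the same Gram matrix are unitarily equivalent. -/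
theorem exists_linearIsometryEquiv_of_inner_eq {X E F : Type*} [NormedAddCommGroup E]
    [InnerProductSpace ℂ E] [CompleteSpace E] [NormedAddCommGroup F] [InnerProductSpace ℂ F]
    [CompleteSpace F] (v : X → E) (w : X → F)
    (hvw : ∀ x y, inner ℂ (v x) (v y) = inner ℂ (w x) (w y))
    (hv : (Submodule.span ℂ (Set.range v)).topologicalClosure = ⊤)
    (hw : (Submodule.span ℂ (Set.range w)).topologicalClosure = ⊤) :
    ∃ J : E ≃ₗᵢ[ℂ] F, ∀ x, J (v x) = w x := by
  have hnorm : ∀ x, ‖Finsupp.linearCombination ℂ w (LinearEquiv.refl ℂ (X →₀ ℂ) x)‖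
      = ‖Finsupp.linearCombination ℂ v x‖ := by
    intro x
    rw [← sq_eq_sq₀ (norm_nonneg _) (norm_nonneg _)]
    have : inner ℂ (Finsupp.linearCombination ℂ w x) (Finsupp.linearCombination ℂ w x)
        = inner ℂ (Finsupp.linearCombination ℂ v x) (Finsupp.linearCombination ℂ v x) := by
      simp only [Finsupp.linearCombination_apply, Finsupp.sum, sum_inner, inner_sum,
        inner_smul_left, inner_smul_right, hvw]
    rw [inner_self_eq_norm_sq_to_K, inner_self_eq_norm_sq_to_K] at this
    exact_mod_cast this
  refine ⟨(LinearEquiv.refl ℂ (X →₀ ℂ)).extendOfIsometry (Finsupp.linearCombination ℂ v)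
    (Finsupp.linearCombination ℂ w) (denseRange_linearCombination hv)
    (denseRange_linearCombination hw) hnorm, fun x => ?_⟩
  have := LinearEquiv.extendOfIsometry_eq (LinearEquiv.refl ℂ (X →₀ ℂ))
    (Finsupp.linearCombination ℂ v) (Finsupp.linearCombination ℂ w) (denseRange_linearCombination hv)
    (denseRange_linearCombination hw) hnorm
    (Finsupp.single x 1)
  simpa using this

/-- `monomialWeight r n * z ^ n`, `n ∈ ℤ`, are the normalized monomials of `AnnulusSpace r`. -/
noncomputable def monomialWeight (r : ℝ) (n : ℤ) : ℝ := r ^ (-n).toNat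

theorem monomialWeight_natCast (r : ℝ) (n : ℕ) : monomialWeight r n = 1 := by
  simp [monomialWeight]

theorem monomialWeight_neg_natCast (r : ℝ) (n : ℕ) : monomialWeight r (-n) = r ^ n := by
  simp [monomialWeight]

theorem monomialWeight_pos {r : ℝ} (h0 : 0 < r) (n : ℤ) : 0 < monomialWeight r n :=
  pow_pos h0 _

theorem hasSum_monomials {r : ℝ} (h0 : 0 < r) {z w : ℂ} (hz : z ∈ annulus r)
    (hw : w ∈ annulus r) :
    HasSum (fun n : ℤ => ((monomialWeight r n : ℂ) * z ^ n) *
      conj ((monomialWeight r n : ℂ) * w ^ n)) (annulusKernel r z w) := by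
  have hz0 : 0 < ‖z‖ := h0.trans hz.1
  have hw0 : 0 < ‖w‖ := h0.trans hw.1
  have h1 : r < 1 := hz.1.trans hz.2
  have hq : ‖z * conj w‖ < 1 := by
    rw [norm_mul, RCLike.norm_conj]
    nlinarith [hz.2, hw.2]
  have hs : ‖(r : ℂ) ^ 2 / (z * conj w)‖ < 1 := by
    rw [norm_div, norm_mul, RCLike.norm_conj, norm_pow, Complex.norm_real, Real.norm_eq_abs,
      abs_of_pos h0, div_lt_one (mul_pos hz0 hw0)]
    nlinarith [hz.1, hw.1]
  have hA := (hasSum_geometric_of_norm_lt_one hq).summable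
  have hB := ((hasSum_geometric_of_norm_lt_one hs).mul_left
    ((r : ℂ) ^ 2 / (z * conj w))).summable
  have hzc : z ≠ 0 := norm_pos_iff.1 hz0
  have hwc : conj w ≠ 0 := by simpa using norm_pos_iff.1 hw0
  have hpos : ∀ n : ℕ, ((monomialWeight r n : ℂ) * z ^ (n : ℤ)) *
      conj ((monomialWeight r n : ℂ) * w ^ (n : ℤ)) = (z * conj w) ^ n := fun n => by
    simp [monomialWeight_natCast, mul_pow]
  have hneg : ∀ n : ℕ, ((monomialWeight r (-(n + 1)) : ℂ) * z ^ (-(n + 1) : ℤ)) *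
      conj ((monomialWeight r (-(n + 1)) : ℂ) * w ^ (-(n + 1) : ℤ))
      = (r : ℂ) ^ 2 / (z * conj w) * ((r : ℂ) ^ 2 / (z * conj w)) ^ n := fun n => by
    have := monomialWeight_neg_natCast r (n + 1)
    push_cast at this
    rw [this, ← pow_succ']
    have e : (-(n + 1) : ℤ) = -((n + 1 : ℕ) : ℤ) := by push_cast; ring
    rw [e, zpow_neg, zpow_neg, zpow_natCast, zpow_natCast]
    simp only [map_mul, map_inv₀, map_pow, Complex.conj_ofReal, Complex.ofReal_pow]
    rw [div_pow, mul_pow]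
    field_simp
    ring
  have hAB := HasSum.of_nat_of_neg_add_one (f := fun n : ℤ => ((monomialWeight r n : ℂ) * z ^ n) *
      conj ((monomialWeight r n : ℂ) * w ^ n)) (hA.hasSum.congr_fun hpos)
      (hB.hasSum.congr_fun hneg)
  convert hAB using 1
  refine (hasSum_annulusKernel h0 h1 ⟨z, hz⟩ ⟨w, hw⟩).unique ?_
  refine (hA.hasSum.add hB.hasSum).congr_fun fun n => ?_
  rw [← pow_succ']
  simp only [map_pow, map_div₀, Complex.conj_ofReal, div_pow, mul_pow]
  field_simp
  ring

theorem summable_norm_monomial_sq {r : ℝ} (h0 : 0 < r) {z : ℂ} (hz : z ∈ annulus r) :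
    Summable fun n : ℤ => ‖conj ((monomialWeight r n : ℂ) * z ^ n)‖ ^ 2 := by
  refine ((hasSum_monomials h0 hz hz).summable.norm).congr fun n => ?_
  rw [norm_mul, RCLike.norm_conj, sq]

/-- An element of `ℓ²` from a square summable family. -/
noncomputable def l2OfSummable {ι : Type*} (c : ι → ℂ) (hc : Summable fun i => ‖c i‖ ^ 2) :
    lp (fun _ : ι => ℂ) 2 :=
  ⟨c, memℓp_gen (by simpa using hc)⟩

theorem l2OfSummable_apply {ι : Type*} (c : ι → ℂ) (hc : Summable fun i => ‖c i‖ ^ 2) (i : ι) :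
    l2OfSummable c hc i = c i := rfl

section

variable (r : Set.Ioo (0 : ℝ) 1)

theorem inner_kerFun_kerFun (z w : annulus (r : ℝ)) :
    inner ℂ (RKHS.kerFun (AnnulusSpace r) z 1) (RKHS.kerFun (AnnulusSpace r) w 1)
      = annulusKernel r z w := by
  rw [← RKHS.kernel_inner, RKHS.OfKernel.kernel_ofKernel]
  simp [annulusKernelMatrix, annulusKernel, mul_comm]

theorem span_kerFun_dense :
    (Submodule.span ℂ (Set.range fun z : annulus (r : ℝ) =>
      RKHS.kerFun (AnnulusSpace r) z 1)).topologicalClosure = ⊤ := by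
  rw [← top_le_iff, ← RKHS.kerFun_dense (𝕜 := ℂ) (AnnulusSpace r)]
  refine Submodule.topologicalClosure_mono (Submodule.span_le.2 ?_)
  rintro _ ⟨z, v, rfl⟩
  have : RKHS.kerFun (AnnulusSpace r) z v = v • RKHS.kerFun (AnnulusSpace r) z 1 := by
    rw [← map_smul]; simp
  rw [this]
  exact Submodule.smul_mem _ _ (Submodule.subset_span ⟨z, rfl⟩)

/-- The vectors `w z` in ℓ² with entries conj(w_n z^n) have the Gram matrix of the kernel functions.
Their span is dense, because pairing c with `w z` gives the Laurent series with coefficients c_n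
w_n, and one that vanishes on the annulus has zero coefficients. The resulting unitary onto ℓ² is
the coordinate map of the basis. -/
theorem exists_annulusBasis : ∃ b : HilbertBasis ℤ ℂ (AnnulusSpace r),
    ∀ (n : ℤ) (z : annulus (r : ℝ)), b n z = monomialWeight r n * (z : ℂ) ^ n := by
  have h0 := r.2.1
  have h1 := r.2.2
  let w : annulus (r : ℝ) → lp (fun _ : ℤ => ℂ) 2 := fun z =>
    l2OfSummable _ (summable_norm_monomial_sq h0 z.2)
  have hw : (Submodule.span ℂ (Set.range w)).topologicalClosure = ⊤ := by
    rw [Submodule.topologicalClosure_eq_top_iff, Submodule.eq_bot_iff]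
    intro c hc
    have hz : ∀ z ∈ annulus (r : ℝ),
        HasSum (fun n : ℤ => (c n * monomialWeight r n) * z ^ n) ((fun _ => (0 : ℂ)) z) := by
      intro z hz
      have h := lp.hasSum_inner (𝕜 := ℂ) (w ⟨z, hz⟩) c
      rw [Submodule.inner_right_of_mem_orthogonal (Submodule.subset_span (Set.mem_range_self _)) hc] at h
      refine h.congr_fun fun n => ?_
      simp only [w, l2OfSummable_apply, RCLike.inner_apply, Complex.conj_conj]
      ring
    ext n
    have hn := laurentCoeff_of_hasSum h0 h1 hz n
    have hi : (∮ _z : ℂ in C(0, √(r : ℝ)), (0 : ℂ)) = 0 := by simp [circleIntegral]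
    simp only [laurentCoeff, mul_zero, hi] at hn
    simpa [(monomialWeight_pos h0 n).ne'] using hn.symm
  obtain ⟨J, hJ⟩ := exists_linearIsometryEquiv_of_inner_eq
    (fun z : annulus (r : ℝ) => RKHS.kerFun (AnnulusSpace r) z 1) w (fun z z' => by
      rw [inner_kerFun_kerFun]
      refine (hasSum_monomials h0 z.2 z'.2).unique ?_
      refine (lp.hasSum_inner (𝕜 := ℂ) (w z) (w z')).congr_fun fun n => ?_
      simp only [w, l2OfSummable_apply, RCLike.inner_apply, Complex.conj_conj]
      ring)
    (span_kerFun_dense r) hw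
  refine ⟨HilbertBasis.ofRepr J, fun n z => ?_⟩
  have h : inner ℂ (RKHS.kerFun (AnnulusSpace r) z 1) ((HilbertBasis.ofRepr J) n)
      = (HilbertBasis.ofRepr J) n z := by
    rw [RKHS.kerFun_inner]; simp
  rw [← h, ← J.inner_map_map, hJ]
  have h2 := (HilbertBasis.ofRepr J).repr_self n
  change J _ = _ at h2
  rw [h2, lp.inner_single_right]
  simp [w, l2OfSummable_apply]

/-- The orthonormal basis of normalized monomials. -/
noncomputable def annulusBasis : HilbertBasis ℤ ℂ (AnnulusSpace r) := (exists_annulusBasis r).choose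

theorem annulusBasis_apply (n : ℤ) (z : annulus (r : ℝ)) :
    annulusBasis r n z = monomialWeight r n * (z : ℂ) ^ n :=
  (exists_annulusBasis r).choose_spec n z

theorem hasSum_annulusBasis (f : AnnulusSpace r) (z : annulus (r : ℝ)) :
    HasSum (fun n : ℤ => ((annulusBasis r).repr f n * monomialWeight r n) * (z : ℂ) ^ n) (f z) := by
  have h := (annulusBasis r).hasSum_repr f
  have h2 := h.map (((ContinuousLinearMap.proj z).comp
    (RKHS.coeCLM ℂ : AnnulusSpace r →L[ℂ] (annulus (r : ℝ) → ℂ))))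
    (ContinuousLinearMap.continuous _)
  refine h2.congr_fun fun n => ?_
  simp [annulusBasis_apply, mul_assoc]

end

/-! ### Multiplication by bounded holomorphic functions: the constant √2 -/

/-- Here (t^n)² + ((r/t)^n)² is the weight of |a_n|² in the sum of the mean squares on the circles
of radius t and r/t. After multiplication by w_n² it becomes t^(2|n|) + (r/t)^(2|n|) for either sign
of n, and both terms are at most 1. -/
theorem monomialWeight_ratio_bounds {r t : ℝ} (h0 : 0 < r) (hr : r < t) (ht : t < 1) (n : ℤ) :
    t ^ (2 * n.natAbs) ≤ ((t ^ n) ^ 2 + ((r / t) ^ n) ^ 2) * monomialWeight r n ^ 2 ∧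
      ((t ^ n) ^ 2 + ((r / t) ^ n) ^ 2) * monomialWeight r n ^ 2 ≤ 2 := by
  have ht0 : 0 < t := h0.trans hr
  have hrt : r / t < 1 := (div_lt_one ht0).2 hr
  have hrt0 : 0 < r / t := div_pos h0 ht0
  have hle : ∀ a : ℝ, 0 < a → a < 1 → ∀ m : ℕ, (a ^ m) ^ 2 ≤ 1 := fun a ha ha1 m =>
    pow_le_one₀ (by positivity) (pow_le_one₀ ha.le ha1.le)
  obtain ⟨m, rfl | rfl⟩ := n.eq_nat_or_neg
  · rw [monomialWeight_natCast]
    simp only [zpow_natCast, Int.natAbs_natCast, one_pow, mul_one]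
    refine ⟨?_, by linarith [hle t ht0 ht m, hle _ hrt0 hrt m]⟩
    rw [mul_comm, pow_mul]
    exact le_add_of_nonneg_right (by positivity)
  · rw [monomialWeight_neg_natCast]
    simp only [zpow_neg, zpow_natCast, Int.natAbs_neg, Int.natAbs_natCast]
    have e : (((t ^ m)⁻¹) ^ 2 + (((r / t) ^ m)⁻¹) ^ 2) * (r ^ m) ^ 2
        = ((r / t) ^ m) ^ 2 + (t ^ m) ^ 2 := by
      simp only [div_pow]
      field_simp
    rw [e]
    refine ⟨?_, by linarith [hle t ht0 ht m, hle _ hrt0 hrt m]⟩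
    rw [mul_comm, pow_mul]
    exact le_add_of_nonneg_left (by positivity)

section

variable (r : Set.Ioo (0 : ℝ) 1)

/-- The function on `ℂ` extending an element of `AnnulusSpace r`. -/
noncomputable def annulusExtend (f : AnnulusSpace r) (z : ℂ) : ℂ :=
  ∑' n : ℤ, ((annulusBasis r).repr f n * monomialWeight r n) * z ^ n

theorem annulusExtend_coe (f : AnnulusSpace r) (z : annulus (r : ℝ)) :
    annulusExtend r f z = f z :=
  (hasSum_annulusBasis r f z).tsum_eq

theorem hasSum_annulusExtend (f : AnnulusSpace r) {z : ℂ} (hz : z ∈ annulus (r : ℝ)) :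
    HasSum (fun n : ℤ => ((annulusBasis r).repr f n * monomialWeight r n) * z ^ n)
      (annulusExtend r f z) :=
  (hasSum_annulusBasis r f ⟨z, hz⟩).summable.hasSum

theorem differentiableOn_annulusExtend (f : AnnulusSpace r) :
    DifferentiableOn ℂ (annulusExtend r f) (annulus (r : ℝ)) :=
  differentiableOn_of_hasSum_zpow r.2.1 fun _ hz => hasSum_annulusExtend r f hz

theorem laurentCoeff_annulusExtend (f : AnnulusSpace r) (n : ℤ) :
    laurentCoeff r (annulusExtend r f) n = (annulusBasis r).repr f n * monomialWeight r n :=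
  laurentCoeff_of_hasSum r.2.1 r.2.2 (fun _ hz => hasSum_annulusExtend r f hz) n

theorem hasSum_repr_sq (f : AnnulusSpace r) :
    HasSum (fun n : ℤ => ‖(annulusBasis r).repr f n‖ ^ 2) (‖f‖ ^ 2) := by
  have h := lp.hasSum_norm (p := 2) (by simp) ((annulusBasis r).repr f)
  simpa using h

/-- A holomorphic function dominated on circles by an element of the space belongs to the space. -/
theorem exists_mem_of_norm_le_mul {g : ℂ → ℂ} (hg : DifferentiableOn ℂ g (annulus (r : ℝ)))
    (f : AnnulusSpace r) {S : ℝ} (hS0 : 0 ≤ S)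
    (hS : ∀ z ∈ annulus (r : ℝ), ‖g z‖ ≤ S * ‖annulusExtend r f z‖) :
    ∃ h : AnnulusSpace r, (∀ z : annulus (r : ℝ), h z = g z) ∧ ‖h‖ ≤ √2 * S * ‖f‖ := by
  have h0 := r.2.1
  have h1 := r.2.2
  have hw := fun n => monomialWeight_pos h0 n
  -- The coordinates that `g` must have in the basis; their square summability is what has to be
  -- shown.
  let d : ℤ → ℂ := fun n => laurentCoeff r g n / monomialWeight r n
  have hcoef : ∀ n, laurentCoeff r g n = d n * monomialWeight r n := fun n => by
    have : (monomialWeight r n : ℂ) ≠ 0 := by exact_mod_cast (hw n).ne'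
    simp only [d]; field_simp
  -- The circles of radius t and r/t stand in for the two boundary circles, where `g` need not be
  -- defined. Finite partial sums allow the passage t → 1 before summability is known.
  have key : ∀ (A : Finset ℤ) (t : ℝ), (r : ℝ) < t → t < 1 →
      ∑ n ∈ A, t ^ (2 * n.natAbs) * ‖d n‖ ^ 2 ≤ 2 * S ^ 2 * ‖f‖ ^ 2 := by
    intro A t hr ht
    have ht0 : 0 < t := h0.trans hr
    have hrt : (r : ℝ) < r / t := by rw [lt_div_iff₀ ht0]; nlinarith
    have hrt1 : r / t < 1 := (div_lt_one ht0).2 hr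
    have hf := differentiableOn_annulusExtend r f
    have hG := (hasSum_laurentCoeff_sq h0 h1 hg hr ht).add
      (hasSum_laurentCoeff_sq h0 h1 hg hrt hrt1)
    have hF := ((hasSum_laurentCoeff_sq h0 h1 hf hr ht).add
      (hasSum_laurentCoeff_sq h0 h1 hf hrt hrt1)).mul_left (S ^ 2)
    have hN := (hasSum_repr_sq r f).mul_left (2 * S ^ 2)
    have hmean : circleMeanSq g t + circleMeanSq g (r / t) ≤
        S ^ 2 * (circleMeanSq (annulusExtend r f) t + circleMeanSq (annulusExtend r f) (r / t)) := by
      rw [mul_add]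
      exact add_le_add (circleMeanSq_mul_le h0 hf.continuousOn hg.continuousOn hS hr ht)
        (circleMeanSq_mul_le h0 hf.continuousOn hg.continuousOn hS hrt hrt1)
    have hmn : ∀ (n : ℤ) (c : ℂ), (t ^ n * ‖c * monomialWeight r n‖) ^ 2
        + ((r / t) ^ n * ‖c * monomialWeight r n‖) ^ 2
        = ((t ^ n) ^ 2 + ((r / t) ^ n) ^ 2) * monomialWeight r n ^ 2 * ‖c‖ ^ 2 := by
      intro n c
      rw [norm_mul, Complex.norm_real, Real.norm_of_nonneg (hw n).le]
      ring
    calc ∑ n ∈ A, t ^ (2 * n.natAbs) * ‖d n‖ ^ 2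
        ≤ ∑ n ∈ A, ((t ^ n * ‖laurentCoeff r g n‖) ^ 2
          + ((r / t) ^ n * ‖laurentCoeff r g n‖) ^ 2) := by
          refine Finset.sum_le_sum fun n _ => ?_
          rw [hcoef, hmn]
          gcongr
          exact (monomialWeight_ratio_bounds h0 hr ht n).1
      _ ≤ circleMeanSq g t + circleMeanSq g (r / t) :=
          sum_le_hasSum A (fun n _ => by positivity) hG
      _ ≤ _ := hmean
      _ ≤ 2 * S ^ 2 * ‖f‖ ^ 2 := by
          refine hasSum_le (fun n => ?_) hF hN
          rw [laurentCoeff_annulusExtend, hmn]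
          have := (monomialWeight_ratio_bounds h0 hr ht n).2
          have h3 : 0 ≤ S ^ 2 * ‖(annulusBasis r).repr f n‖ ^ 2 := by positivity
          nlinarith
  have hfin : ∀ A : Finset ℤ, ∑ n ∈ A, ‖d n‖ ^ 2 ≤ 2 * S ^ 2 * ‖f‖ ^ 2 := by
    intro A
    have hc : Continuous fun t : ℝ => ∑ n ∈ A, t ^ (2 * n.natAbs) * ‖d n‖ ^ 2 := by fun_prop
    have hlim : Tendsto (fun t : ℝ => ∑ n ∈ A, t ^ (2 * n.natAbs) * ‖d n‖ ^ 2) (𝓝[<] 1)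
        (𝓝 (∑ n ∈ A, ‖d n‖ ^ 2)) := by
      have := (hc.tendsto 1).mono_left (nhdsWithin_le_nhds (s := Set.Iio (1 : ℝ)))
      simpa using this
    refine le_of_tendsto hlim ?_
    filter_upwards [Ioo_mem_nhdsLT h1] with t ht
    exact key A t ht.1 ht.2
  have hd : Summable fun n => ‖d n‖ ^ 2 :=
    summable_of_sum_le (fun n => by positivity) hfin
  refine ⟨(annulusBasis r).repr.symm (l2OfSummable d hd), fun z => ?_, ?_⟩
  · refine (hasSum_annulusBasis r _ z).unique ?_
    refine (hasSum_laurentCoeff h0 h1 hg z.2).congr_fun fun n => ?_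
    rw [LinearIsometryEquiv.apply_symm_apply, l2OfSummable_apply, hcoef]
  · have h := hasSum_repr_sq r ((annulusBasis r).repr.symm (l2OfSummable d hd))
    have h2 := h.summable.tsum_le_of_sum_le (fun A => by
      simpa [l2OfSummable_apply] using hfin A)
    rw [h.tsum_eq] at h2
    refine le_of_sq_le_sq ?_ (by positivity)
    rw [mul_pow, mul_pow, Real.sq_sqrt zero_le_two]
    exact h2

theorem norm_le_supNorm {φ : ℂ → ℂ} (hφ : MemHInfty r φ) {z : ℂ} (hz : z ∈ annulus (r : ℝ)) :
    ‖φ z‖ ≤ supNorm r φ := by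
  obtain ⟨C, hC⟩ := hφ.2
  exact le_ciSup (f := fun z : annulus (r : ℝ) => ‖φ z‖)
    ⟨C, by rintro _ ⟨w, rfl⟩; exact hC w w.2⟩ ⟨z, hz⟩

theorem supNorm_nonneg (φ : ℂ → ℂ) : 0 ≤ supNorm r φ :=
  Real.iSup_nonneg fun _ => norm_nonneg _

theorem exists_mul_mem {φ : ℂ → ℂ} (hφ : MemHInfty r φ) (f : AnnulusSpace r) :
    ∃ h : AnnulusSpace r, (∀ z : annulus (r : ℝ), h z = φ z * f z) ∧
      ‖h‖ ≤ √2 * supNorm r φ * ‖f‖ := by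
  obtain ⟨h, hh, hn⟩ := exists_mem_of_norm_le_mul r
    (hφ.1.mul (differentiableOn_annulusExtend r f)) f (supNorm_nonneg r φ) (fun z hz => by
      rw [Pi.mul_apply, norm_mul]
      gcongr
      exact norm_le_supNorm r hφ hz)
  exact ⟨h, fun z => by rw [hh, Pi.mul_apply, annulusExtend_coe], hn⟩

theorem isMultiplier_of_memHInfty {φ : ℂ → ℂ} (hφ : MemHInfty r φ) :
    IsMultiplier (AnnulusSpace r) (fun z : annulus (r : ℝ) => φ z) := by
  choose M hM hMn using exists_mul_mem r hφ
  refine ⟨LinearMap.mkContinuous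
    { toFun := M
      map_add' := fun f g => RKHS.ext fun z => by
        simp only [RKHS.coe_add, Pi.add_apply, hM]; ring
      map_smul' := fun c f => RKHS.ext fun z => by
        simp only [RKHS.coe_smul, Pi.smul_apply, hM, smul_eq_mul, RingHom.id_apply]; ring }
    (√2 * supNorm r φ) hMn, fun f z => hM f z⟩

theorem multOp_apply {φ : ℂ → ℂ} (hφ : MemHInfty r φ) (f : AnnulusSpace r)
    (z : annulus (r : ℝ)) :
    multOp (AnnulusSpace r) (fun z : annulus (r : ℝ) => φ z) f z = φ z * f z := by
  have h := isMultiplier_of_memHInfty r hφ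
  rw [multOp, dif_pos h]
  exact h.choose_spec f z

theorem multNorm_le {φ : ℂ → ℂ} (hφ : MemHInfty r φ) :
    multNorm (AnnulusSpace r) (fun z : annulus (r : ℝ) => φ z) ≤ √2 * supNorm r φ := by
  refine ContinuousLinearMap.opNorm_le_bound _
    (mul_nonneg (Real.sqrt_nonneg _) (supNorm_nonneg r φ)) fun f => ?_
  obtain ⟨h, hh, hn⟩ := exists_mul_mem r hφ f
  have : multOp (AnnulusSpace r) (fun z : annulus (r : ℝ) => φ z) f = h :=
    RKHS.ext fun z => by rw [multOp_apply r hφ, hh]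
  rwa [this]

/-- The matrix of the multiplication operator in the basis of normalized monomials. -/
theorem inner_multOp {φ : ℂ → ℂ} (hφ : MemHInfty r φ) (k n : ℤ) :
    inner ℂ (annulusBasis r k)
      (multOp (AnnulusSpace r) (fun z : annulus (r : ℝ) => φ z) (annulusBasis r n))
      = laurentCoeff r φ (k - n) * ((monomialWeight r n / monomialWeight r k : ℝ) : ℂ) := by
  set g := multOp (AnnulusSpace r) (fun z : annulus (r : ℝ) => φ z) (annulusBasis r n) with hg
  have hwk : (monomialWeight r k : ℂ) ≠ 0 := by exact_mod_cast (monomialWeight_pos r.2.1 k).ne'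
  have h1 := laurentCoeff_annulusExtend r g k
  have h2 := laurentCoeff_of_hasSum r.2.1 r.2.2 (f := annulusExtend r g)
    (c := fun m => laurentCoeff r φ (m - n) * monomialWeight r n) (fun z hz => by
      have hz0 : z ≠ 0 := norm_pos_iff.1 (r.2.1.trans hz.1)
      have h := (hasSum_laurentCoeff r.2.1 r.2.2 hφ.1 hz).mul_right (monomialWeight r n * z ^ n)
      rw [annulusExtend_coe r g ⟨z, hz⟩, hg, multOp_apply r hφ, annulusBasis_apply]
      refine ((Equiv.subRight n).hasSum_iff.2 h).congr_fun fun m => ?_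
      simp only [Function.comp_apply, Equiv.subRight_apply]
      rw [zpow_sub₀ hz0]
      field_simp) k
  rw [← HilbertBasis.repr_apply_apply]
  rw [h1] at h2
  push_cast
  field_simp
  exact h2

end

/-! ### The defect operator and the upper bound for ‖φ(T)‖ -/

theorem monomialWeight_sq_neg_succ (r : ℝ) (m : ℕ) :
    monomialWeight r (-((m : ℤ) + 1)) ^ 2 = r ^ (2 * (m + 1)) := by
  have := monomialWeight_neg_natCast r (m + 1)
  push_cast at this
  rw [this, ← pow_mul, mul_comm]

/-- Summation by parts: w_n² satisfies (r² + 1) w_n² - r² w_(n+1)² - w_(n-1)² = 0 for n ≠ 0, while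
for n = 0 the value is 1 - r². So only x_0 survives, the decay hypotheses removing the boundary
terms. Nonnegativity turns convergence of the partial sums into summability. -/
theorem hasSum_annulus_telescope {r : ℝ} {x : ℤ → ℝ}
    (hx : Tendsto (fun n : ℕ => x n) atTop (𝓝 0))
    (hx' : Tendsto (fun n : ℕ => r ^ (2 * n) * x (-(n : ℤ))) atTop (𝓝 0))
    (hq : ∀ n : ℤ, 0 ≤ (r ^ 2 + 1) * x n - r ^ 2 * x (n - 1) - x (n + 1)) :
    HasSum (fun n : ℤ => monomialWeight r n ^ 2 *
      ((r ^ 2 + 1) * x n - r ^ 2 * x (n - 1) - x (n + 1))) ((1 - r ^ 2) * x 0) := by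
  have hsplit : (1 - r ^ 2) * x 0 = (x 0 - r ^ 2 * x (-1)) + (r ^ 2 * x (-1) - r ^ 2 * x 0) := by
    ring
  rw [hsplit]
  refine HasSum.of_nat_of_neg_add_one ?_ ?_
  · rw [hasSum_iff_tendsto_nat_of_nonneg fun n => mul_nonneg (sq_nonneg _) (hq n)]
    rw [← tendsto_add_atTop_iff_nat 1]
    have hpart : ∀ N : ℕ, ∑ n ∈ Finset.range (N + 1), monomialWeight r n ^ 2 *
        ((r ^ 2 + 1) * x n - r ^ 2 * x (n - 1) - x (n + 1))
        = x 0 - x (N + 1 : ℕ) - r ^ 2 * (x (-1) - x N) := by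
      intro N
      induction N with
      | zero =>
        rw [zero_add, Finset.sum_range_one, monomialWeight_natCast]
        simp only [Nat.cast_zero, Nat.cast_one, zero_add, zero_sub]
        ring
      | succ N ih =>
        rw [Finset.sum_range_succ, ih, monomialWeight_natCast]
        push_cast
        rw [add_sub_cancel_right]
        ring
    simp_rw [hpart]
    have := ((tendsto_const_nhds (x := x 0)).sub ((tendsto_add_atTop_iff_nat 1).2 hx)).sub
      (((tendsto_const_nhds (x := x (-1))).sub hx).const_mul (r ^ 2))
    simpa using this
  · rw [hasSum_iff_tendsto_nat_of_nonneg fun n => mul_nonneg (sq_nonneg _) (hq _)]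
    have hpart : ∀ N : ℕ, ∑ n ∈ Finset.range N, monomialWeight r (-((n : ℤ) + 1)) ^ 2 *
        ((r ^ 2 + 1) * x (-((n : ℤ) + 1)) - r ^ 2 * x (-((n : ℤ) + 1) - 1)
          - x (-((n : ℤ) + 1) + 1))
        = r ^ 2 * x (-1) - r ^ (2 * (N + 1)) * x (-((N + 1 : ℕ) : ℤ))
          + r ^ 2 * (r ^ (2 * N) * x (-(N : ℤ)) - x 0) := by
      intro N
      induction N with
      | zero => simp
      | succ N ih =>
        rw [Finset.sum_range_succ, ih, monomialWeight_sq_neg_succ]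
        have e1 : -((N : ℤ) + 1) - 1 = -((N + 1 + 1 : ℕ) : ℤ) := by push_cast; ring
        have e2 : -((N : ℤ) + 1) + 1 = -(N : ℤ) := by ring
        have e3 : -((N : ℤ) + 1) = -((N + 1 : ℕ) : ℤ) := by push_cast; ring
        rw [e1, e2, e3]
        ring
    simp_rw [hpart]
    have := ((tendsto_const_nhds (x := r ^ 2 * x (-1))).sub
      ((tendsto_add_atTop_iff_nat 1).2 hx')).add
      ((hx'.sub (tendsto_const_nhds (x := x 0))).const_mul (r ^ 2))
    convert this using 2
    ring

/-- Gelfand's formula for the spectral radius, with a number `a` strictly between that radius and R.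
-/
theorem exists_norm_pow_le_of_spectrum {A : Type*} [NormedRing A] [NormedAlgebra ℂ A]
    [CompleteSpace A] {T : A} {R : ℝ} (hR : 0 < R) (h : ∀ z ∈ spectrum ℂ T, ‖z‖ < R) :
    ∃ C a : ℝ, 0 < a ∧ a < R ∧ 0 < C ∧ ∀ n : ℕ, ‖T ^ n‖ ≤ C * a ^ n := by
  have hrad : spectralRadius ℂ T < ENNReal.ofReal R := by
    -- The spectrum is empty when the algebra is trivial.
    rcases (spectrum ℂ T).eq_empty_or_nonempty with he | hne
    · simp [spectralRadius, he, hR]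
    · exact spectrum.spectralRadius_lt_of_forall_lt_of_nonempty (𝕜 := ℂ) hne (r := R.toNNReal)
        fun k hk => by
          rw [← NNReal.coe_lt_coe, Real.coe_toNNReal _ hR.le]; exact h k hk
  obtain ⟨a, ha1, ha2⟩ := exists_between hrad
  have hatop : a ≠ ⊤ := (ha2.trans ENNReal.ofReal_lt_top).ne
  have ha0 : 0 < a := zero_le.trans_lt ha1
  have hev := (spectrum.pow_nnnorm_pow_one_div_tendsto_nhds_spectralRadius T).eventually_lt_const ha1
  have ha : 0 < a.toReal := ENNReal.toReal_pos ha0.ne' hatop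
  have hO : (fun n : ℕ => T ^ n) =O[atTop] fun n : ℕ => a.toReal ^ n := by
    refine Asymptotics.IsBigO.of_bound 1 ?_
    filter_upwards [hev, eventually_gt_atTop 0] with n hn hn0
    have hn' : (n : ℝ) ≠ 0 := by positivity
    have h2 := ENNReal.rpow_le_rpow hn.le (Nat.cast_nonneg n (α := ℝ))
    rw [← ENNReal.rpow_mul, one_div_mul_cancel hn', ENNReal.rpow_one, ENNReal.rpow_natCast] at h2
    have h3 := ENNReal.toReal_mono (ENNReal.pow_ne_top hatop) h2
    rw [ENNReal.toReal_pow] at h3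
    rw [one_mul, Real.norm_of_nonneg (by positivity)]
    simpa using h3
  obtain ⟨C, hC, hb⟩ := Asymptotics.bound_of_isBigO_nat_atTop hO
  refine ⟨C, a.toReal, ha, ?_, hC, fun n => ?_⟩
  · rw [← ENNReal.ofReal_lt_ofReal_iff hR, ENNReal.ofReal_toReal hatop]; exact ha2
  · have := hb (x := n) (by positivity)
    rwa [Real.norm_of_nonneg (by positivity)] at this

section

variable {H : Type u} [NormedAddCommGroup H] [InnerProductSpace ℂ H]

theorem opZPow_units (u : (H →L[ℂ] H)ˣ) (n : ℤ) :
    opZPow (u : H →L[ℂ] H) n = ((u ^ n : (H →L[ℂ] H)ˣ) : H →L[ℂ] H) := by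
  cases n with
  | ofNat n => simp [opZPow]
  | negSucc n => simp [opZPow, zpow_negSucc, ← inv_pow]

variable [CompleteSpace H]

theorem isUnit_of_mem_classF {r : ℝ} (h0 : 0 < r) {T : H →L[ℂ] H} (hT : T ∈ classF r H) :
    IsUnit T := by
  rw [← spectrum.zero_notMem_iff (R := ℂ)]
  intro h
  have := (hT.1 h).1
  rw [norm_zero] at this
  exact absurd h0 this.not_gt

/-- Gelfand's formula is applied to T with R = 1 and to T⁻¹ with R = 1/r. The same bounds serve the
convergence of the series for φ(T) and the decay needed for telescoping. -/
theorem exists_norm_zpow_le {r : ℝ} (h0 : 0 < r) {u : (H →L[ℂ] H)ˣ}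
    (hT : (u : H →L[ℂ] H) ∈ classF r H) :
    ∃ C a : ℝ, 0 < a ∧ a < 1 ∧ 0 < C ∧
      (∀ n : ℕ, ‖((u ^ (n : ℤ) : (H →L[ℂ] H)ˣ) : H →L[ℂ] H)‖ ≤ C * a ^ n) ∧
      ∀ n : ℕ, r ^ n * ‖((u ^ (-(n : ℤ)) : (H →L[ℂ] H)ˣ) : H →L[ℂ] H)‖ ≤ C * a ^ n := by
  obtain ⟨C, a, ha0, ha1, hC, h⟩ := exists_norm_pow_le_of_spectrum (T := (u : H →L[ℂ] H)) one_pos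
    fun z hz => (hT.1 hz).2
  obtain ⟨C', a', ha0', ha1', hC', h'⟩ := exists_norm_pow_le_of_spectrum
    (T := ((u⁻¹ : (H →L[ℂ] H)ˣ) : H →L[ℂ] H)) (R := r⁻¹) (by positivity) fun z hz => by
      rw [← spectrum.map_inv, Set.mem_inv] at hz
      have := (hT.1 hz).1
      rw [norm_inv] at this
      exact (lt_inv_comm₀ h0 (inv_pos.1 (h0.trans this))).1 this
  have hra : r * a' < 1 := by
    rw [lt_inv_comm₀ ha0' h0] at ha1'
    calc r * a' < a'⁻¹ * a' := by gcongr
      _ = 1 := inv_mul_cancel₀ ha0'.ne'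
  refine ⟨max C C', max a (r * a'), lt_max_of_lt_left ha0, max_lt ha1 hra, lt_max_of_lt_left hC,
    fun n => ?_, fun n => ?_⟩
  · simp only [zpow_natCast, Units.val_pow_eq_pow_val]
    refine (h n).trans ?_
    gcongr
    · exact le_max_left _ _
    · exact le_max_left _ _
  · simp only [zpow_neg, zpow_natCast, ← inv_pow, Units.val_pow_eq_pow_val]
    calc r ^ n * _ ≤ r ^ n * (C' * a' ^ n) := by gcongr; exact h' n
      _ = C' * (r * a') ^ n := by rw [mul_pow]; ring
      _ ≤ _ := by
        gcongr
        · exact le_max_right _ _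
        · exact le_max_right _ _

/-- Cauchy estimates with the radius tending to 1 for the first bound and to r for the second. -/
theorem norm_laurentCoeff_natCast_le (r : Set.Ioo (0 : ℝ) 1) {φ : ℂ → ℂ} (hφ : MemHInfty r φ)
    (n : ℕ) : ‖laurentCoeff r φ n‖ ≤ supNorm r φ ∧
      ‖laurentCoeff r φ (-(n : ℤ))‖ ≤ supNorm r φ * (r : ℝ) ^ n := by
  have h0 := r.2.1
  have h1 := r.2.2
  have hb : ∀ (m : ℤ) (t : ℝ), (r : ℝ) < t → t < 1 → t ^ m * ‖laurentCoeff r φ m‖ ≤ supNorm r φ :=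
    fun m t hr ht => norm_laurentCoeff_le h0 h1 hφ.1 hr ht
      (fun z hz => norm_le_supNorm r hφ ⟨hz ▸ hr, hz ▸ ht⟩) m
  constructor
  · have hc : Continuous fun t : ℝ => t ^ n * ‖laurentCoeff r φ n‖ := by fun_prop
    have hlim := (hc.tendsto 1).mono_left (nhdsWithin_le_nhds (s := Set.Iio (1 : ℝ)))
    rw [one_pow, one_mul] at hlim
    refine le_of_tendsto hlim ?_
    filter_upwards [Ioo_mem_nhdsLT h1] with t ht
    simpa using hb n t ht.1 ht.2
  · have hc : Continuous fun t : ℝ => supNorm r φ * t ^ n := by fun_prop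
    have hlim := (hc.tendsto (r : ℝ)).mono_left (nhdsWithin_le_nhds (s := Set.Ioi (r : ℝ)))
    refine ge_of_tendsto hlim ?_
    filter_upwards [Ioo_mem_nhdsGT h1] with t ht
    have ht0 : 0 < t := h0.trans ht.1
    have := hb (-n) t ht.1 ht.2
    rw [zpow_neg, zpow_natCast, inv_mul_le_iff₀ (by positivity)] at this
    rwa [mul_comm]

theorem summable_laurentTerm (r : Set.Ioo (0 : ℝ) 1) {φ : ℂ → ℂ} (hφ : MemHInfty r φ)
    {T : H →L[ℂ] H} (hT : T ∈ classF (r : ℝ) H) : Summable (laurentTerm (r : ℝ) φ T) := by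
  obtain ⟨u, rfl⟩ := isUnit_of_mem_classF r.2.1 hT
  obtain ⟨C, a, ha0, ha1, hC, h1, h2⟩ := exists_norm_zpow_le r.2.1 hT
  have hS := supNorm_nonneg r φ
  refine summable_int_of_le_geometric (C := supNorm r φ * C) ha0.le ha1 ha0.le ha1 (fun n => ?_)
    fun n => ?_
  · rw [laurentTerm, opZPow_units, norm_smul, mul_assoc]
    exact mul_le_mul (norm_laurentCoeff_natCast_le r hφ n).1 (h1 n) (norm_nonneg _) hS
  · rw [laurentTerm, opZPow_units, norm_smul]
    calc _ ≤ supNorm r φ * (r : ℝ) ^ n * _ :=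
          mul_le_mul_of_nonneg_right (norm_laurentCoeff_natCast_le r hφ n).2 (norm_nonneg _)
      _ = supNorm r φ * ((r : ℝ) ^ n * _) := mul_assoc _ _ _
      _ ≤ supNorm r φ * (C * a ^ n) := mul_le_mul_of_nonneg_left (h2 n) hS
      _ = _ := by ring

end

/-- Comparison of vector-valued square sums from a comparison of the scalar ones. -/
theorem sum_sq_le_of_inner {E : Type*} [NormedAddCommGroup E] [InnerProductSpace ℂ E]
    [CompleteSpace E] {v v' : ℤ → E} {A B c : ℝ} (hv : HasSum (fun n => ‖v n‖ ^ 2) A)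
    (hv' : HasSum (fun n => ‖v' n‖ ^ 2) B)
    (h : ∀ x : E, ∑' n, ‖inner ℂ x (v' n)‖ ^ 2 ≤ c * ∑' n, ‖inner ℂ x (v n)‖ ^ 2) :
    B ≤ c * A := by
  -- Each ‖v n‖² is expanded in an orthonormal basis of E and the two nonnegative sums are
  -- interchanged; the scalar hypothesis then applies to each basis vector.
  obtain ⟨w, b, -⟩ := exists_hilbertBasis ℂ E
  have hb : ∀ y : E, HasSum (fun i => ‖inner ℂ (b i) y‖ ^ 2) (‖y‖ ^ 2) := by
    intro y
    have h := lp.hasSum_norm (p := 2) (by simp) (b.repr y)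
    simpa [HilbertBasis.repr_apply_apply] using h
  have hswap : ∀ {u : ℤ → E} {s : ℝ}, HasSum (fun n => ‖u n‖ ^ 2) s →
      HasSum (fun i => ∑' n, ‖inner ℂ (b i) (u n)‖ ^ 2) s := by
    intro u s hu
    have hprod : Summable fun p : ℤ × w => ‖inner ℂ (b p.2) (u p.1)‖ ^ 2 := by
      rw [summable_prod_of_nonneg fun p => by positivity]
      exact ⟨fun n => (hb (u n)).summable, hu.summable.congr fun n => ((hb (u n)).tsum_eq).symm⟩
    have h1 : ∑' p : ℤ × w, ‖inner ℂ (b p.2) (u p.1)‖ ^ 2 = s := by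
      rw [hprod.tsum_prod, ← hu.tsum_eq]
      exact tsum_congr fun n => (hb (u n)).tsum_eq
    have h2 : HasSum (fun p : w × ℤ => ‖inner ℂ (b p.1) (u p.2)‖ ^ 2) s := by
      have := (Equiv.prodComm w ℤ).hasSum_iff.2 (h1 ▸ hprod.hasSum)
      exact this
    exact h2.prod_fiberwise fun i => (h2.summable.prod_factor i).hasSum
  exact hasSum_le (fun i => h (b i)) (hswap hv') ((hswap hv).mul_left c)

section

variable {H : Type u} [NormedAddCommGroup H] [InnerProductSpace ℂ H] [CompleteSpace H]

theorem adjoint_zpow_add (u : (H →L[ℂ] H)ˣ) (n m : ℤ) (h : H) :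
    adjoint ((u ^ n : (H →L[ℂ] H)ˣ) : H →L[ℂ] H)
      (adjoint ((u ^ m : (H →L[ℂ] H)ˣ) : H →L[ℂ] H) h)
      = adjoint ((u ^ (n + m) : (H →L[ℂ] H)ˣ) : H →L[ℂ] H) h := by
  rw [add_comm n m, zpow_add, Units.val_mul]
  simp only [← star_eq_adjoint, star_mul]
  rfl

/-- A square root of the defect operator of an element of the class `F_r`. -/
theorem exists_defect {r : ℝ} {u : (H →L[ℂ] H)ˣ} (hT : (u : H →L[ℂ] H) ∈ classF r H) :
    ∃ D : H →L[ℂ] H, ∀ (h : H) (n : ℤ),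
      ‖D (adjoint ((u ^ n : (H →L[ℂ] H)ˣ) : H →L[ℂ] H) h)‖ ^ 2 =
        (r ^ 2 + 1) * ‖adjoint ((u ^ n : (H →L[ℂ] H)ˣ) : H →L[ℂ] H) h‖ ^ 2
        - r ^ 2 * ‖adjoint ((u ^ (n - 1) : (H →L[ℂ] H)ˣ) : H →L[ℂ] H) h‖ ^ 2
        - ‖adjoint ((u ^ (n + 1) : (H →L[ℂ] H)ˣ) : H →L[ℂ] H) h‖ ^ 2 := by
  -- The defect is a nonnegative element of a C*-algebra, hence of the form D*D. Evaluating its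
  -- quadratic form at (T*)^n h gives the three norms.
  obtain ⟨D, hD⟩ := CStarAlgebra.nonneg_iff_eq_star_mul_self.1 (sub_nonneg.2 hT.2)
  rw [Ring.inverse_unit] at hD
  refine ⟨D, fun h n => ?_⟩
  set y := adjoint ((u ^ n : (H →L[ℂ] H)ˣ) : H →L[ℂ] H) h with hy
  have hm : adjoint ((u ^ (n - 1) : (H →L[ℂ] H)ˣ) : H →L[ℂ] H) h
      = adjoint ((u⁻¹ : (H →L[ℂ] H)ˣ) : H →L[ℂ] H) y := by
    have := adjoint_zpow_add u (-1) n h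
    rw [zpow_neg_one, neg_add_eq_sub] at this
    exact this.symm
  have hp : adjoint ((u ^ (n + 1) : (H →L[ℂ] H)ˣ) : H →L[ℂ] H) h
      = adjoint (u : H →L[ℂ] H) y := by
    have := adjoint_zpow_add u 1 n h
    rw [zpow_one, add_comm] at this
    exact this.symm
  rw [hm, hp]
  have key := congrArg (fun A : H →L[ℂ] H => inner ℂ y (A y)) hD
  simp only [star_eq_adjoint, sub_apply, smul_apply, add_apply, FunLike.coe_mul_eq_comp, Function.comp_apply, one_apply_eq_self,
    inner_sub_right, inner_add_right, inner_smul_right] at key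
  rw [adjoint_inner_right D] at key
  simp only [← adjoint_inner_left, inner_self_eq_norm_sq_to_K] at key
  have := congrArg Complex.re key.symm
  norm_cast at this
  simp only [Complex.coe_algebraMap] at this
  norm_cast at this
  linarith

theorem hasSum_defect {r : ℝ} (h0 : 0 < r) {u : (H →L[ℂ] H)ˣ}
    (hT : (u : H →L[ℂ] H) ∈ classF r H) {D : H →L[ℂ] H}
    (hD : ∀ (h : H) (n : ℤ),
      ‖D (adjoint ((u ^ n : (H →L[ℂ] H)ˣ) : H →L[ℂ] H) h)‖ ^ 2 =
        (r ^ 2 + 1) * ‖adjoint ((u ^ n : (H →L[ℂ] H)ˣ) : H →L[ℂ] H) h‖ ^ 2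
        - r ^ 2 * ‖adjoint ((u ^ (n - 1) : (H →L[ℂ] H)ˣ) : H →L[ℂ] H) h‖ ^ 2
        - ‖adjoint ((u ^ (n + 1) : (H →L[ℂ] H)ˣ) : H →L[ℂ] H) h‖ ^ 2) (h : H) :
    HasSum (fun n : ℤ => ‖(monomialWeight r n : ℂ) •
      D (adjoint ((u ^ n : (H →L[ℂ] H)ˣ) : H →L[ℂ] H) h)‖ ^ 2) ((1 - r ^ 2) * ‖h‖ ^ 2) := by
  obtain ⟨C, a, ha0, ha1, hC, h1, h2⟩ := exists_norm_zpow_le h0 hT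
  have hlim : Tendsto (fun n : ℕ => (C * a ^ n * ‖h‖) ^ 2) atTop (𝓝 0) := by
    have := (((tendsto_pow_atTop_nhds_zero_of_lt_one ha0.le ha1).const_mul C).mul_const ‖h‖).pow 2
    simpa using this
  have hb : ∀ n : ℤ, ‖adjoint ((u ^ n : (H →L[ℂ] H)ˣ) : H →L[ℂ] H) h‖
      ≤ ‖((u ^ n : (H →L[ℂ] H)ˣ) : H →L[ℂ] H)‖ * ‖h‖ := fun n => by
    refine (le_opNorm _ _).trans (le_of_eq ?_)
    rw [LinearIsometryEquiv.norm_map]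
  have h := hasSum_annulus_telescope (r := r)
    (x := fun n : ℤ => ‖adjoint ((u ^ n : (H →L[ℂ] H)ˣ) : H →L[ℂ] H) h‖ ^ 2)
    (squeeze_zero (fun n => by positivity) (fun n => by
      gcongr
      exact (hb n).trans (by gcongr; exact h1 n)) hlim)
    (squeeze_zero (fun n => by positivity) (fun n => by
      rw [mul_comm 2 n, pow_mul, ← mul_pow]
      refine pow_le_pow_left₀ (by positivity) ?_ 2
      calc _ ≤ r ^ n * (‖((u ^ (-(n : ℤ)) : (H →L[ℂ] H)ˣ) : H →L[ℂ] H)‖ * ‖h‖) :=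
            mul_le_mul_of_nonneg_left (hb _) (by positivity)
        _ = r ^ n * ‖((u ^ (-(n : ℤ)) : (H →L[ℂ] H)ˣ) : H →L[ℂ] H)‖ * ‖h‖ := by ring
        _ ≤ _ := mul_le_mul_of_nonneg_right (h2 n) (norm_nonneg _)) hlim)
    (fun n => by rw [← hD]; positivity)
  simp only [zpow_zero, Units.val_one, ← star_eq_adjoint, star_one, one_apply_eq_self] at h
  refine h.congr_fun fun n => ?_
  rw [norm_smul, mul_pow, hD, Complex.norm_real, Real.norm_of_nonneg (monomialWeight_pos h0 n).le]
  rfl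

theorem norm_funcCalc_le (r : Set.Ioo (0 : ℝ) 1) {φ : ℂ → ℂ} (hφ : MemHInfty r φ)
    {T : H →L[ℂ] H} (hT : T ∈ classF (r : ℝ) H) :
    ‖funcCalc (r : ℝ) φ T‖ ≤ multNorm (AnnulusSpace r) (fun z : annulus (r : ℝ) => φ z) := by
  have h0 := r.2.1
  have h1 := r.2.2
  have hsum := (summable_laurentTerm r hφ hT).hasSum
  rw [← funcCalc] at hsum
  obtain ⟨u, rfl⟩ := isUnit_of_mem_classF h0 hT
  obtain ⟨D, hD⟩ := exists_defect hT
  have hDs := hasSum_defect h0 hT hD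
  set A := funcCalc (r : ℝ) φ (u : H →L[ℂ] H) with hA
  set M := multOp (AnnulusSpace r) (fun z : annulus (r : ℝ) => φ z) with hM
  rw [multNorm, ← hM, ← LinearIsometryEquiv.norm_map adjoint A]
  refine opNorm_le_bound _ (norm_nonneg _) fun h => ?_
  let v : H → ℤ → H := fun h n => (monomialWeight r n : ℂ) •
      D (adjoint ((u ^ n : (H →L[ℂ] H)ˣ) : H →L[ℂ] H) h)
  -- The coefficients in `hv` are the entries of the adjoint of the matrix of M_φ, see
  -- `inner_multOp`: this is the intertwining of φ(T)* with M_φ*.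
  have hw : ∀ n, (monomialWeight r n : ℂ) ≠ 0 := fun n => by
    exact_mod_cast (monomialWeight_pos h0 n).ne'
  have hv : ∀ (x : H) (n : ℤ), HasSum (fun k : ℤ => conj (laurentCoeff r φ (k - n) *
      ((monomialWeight r n / monomialWeight r k : ℝ) : ℂ)) * inner ℂ x (v h k))
      (inner ℂ x (v (adjoint A h) n)) := by
    intro x n
    have e1 := ((adjoint : (H →L[ℂ] H) ≃ₗᵢ⋆[ℂ] (H →L[ℂ] H)).toContinuousLinearEquiv.hasSum').2 hsum
    have e2 := (ContinuousLinearMap.apply ℂ H h).hasSum e1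
    have e3 := ((innerSL ℂ x).comp (((monomialWeight r n : ℂ) • D).comp
      (adjoint ((u ^ n : (H →L[ℂ] H)ˣ) : H →L[ℂ] H)))).hasSum e2
    refine ((Equiv.subRight n).hasSum_iff.2 e3).congr_fun fun k => ?_
    have e4 : laurentTerm (r : ℝ) φ (u : H →L[ℂ] H) (k - n)
        = laurentCoeff r φ (k - n) • ((u ^ (k - n) : (H →L[ℂ] H)ˣ) : H →L[ℂ] H) := by
      rw [laurentTerm, opZPow_units]
    have e5 := adjoint_zpow_add u n (k - n) h
    rw [add_sub_cancel] at e5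
    have e6 : (LinearIsometryEquiv.toContinuousLinearEquiv adjoint)
        (laurentTerm (r : ℝ) φ (u : H →L[ℂ] H) (k - n))
        = conj (laurentCoeff r φ (k - n)) •
          adjoint ((u ^ (k - n) : (H →L[ℂ] H)ˣ) : H →L[ℂ] H) := by
      rw [e4]
      exact LinearIsometryEquiv.map_smulₛₗ adjoint _ _
    simp only [Function.comp_apply, Equiv.subRight_apply, e6, ContinuousLinearMap.apply_apply,
      smul_apply, comp_apply, map_smul, e5, innerSL_apply_apply, v, inner_smul_right, smul_eq_mul,
      map_mul, Complex.ofReal_div, map_div₀, Complex.conj_ofReal]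
    have := hw k
    field_simp
  -- Pairing with a fixed x turns the sequence `v h` into the coordinates of a function f in
  -- `AnnulusSpace r`, and `v (adjoint A h)` into those of M_φ* f.
  have hle := sum_sq_le_of_inner (c := ‖M‖ ^ 2) (hDs h) (hDs (adjoint A h)) fun x => by
    have hx : Summable fun n => ‖inner ℂ x (v h n)‖ ^ 2 := by
      refine Summable.of_nonneg_of_le (fun n => by positivity) (fun n => ?_)
        ((hDs h).summable.mul_left (‖x‖ ^ 2))
      rw [← mul_pow]
      gcongr
      exact norm_inner_le_norm _ _
    let f := (annulusBasis r).repr.symm (l2OfSummable _ hx)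
    have hf : ∀ n, (annulusBasis r).repr f n = inner ℂ x (v h n) := fun n => by
      simp only [f, LinearIsometryEquiv.apply_symm_apply, l2OfSummable_apply]
    have hg : ∀ n, (annulusBasis r).repr (adjoint M f) n = inner ℂ x (v (adjoint A h) n) := by
      intro n
      rw [HilbertBasis.repr_apply_apply, adjoint_inner_right]
      refine ((annulusBasis r).hasSum_inner_mul_inner _ _).unique ((hv x n).congr_fun fun k => ?_)
      rw [← hf, HilbertBasis.repr_apply_apply, ← inner_multOp r hφ, inner_conj_symm]
    have s1 := (hasSum_repr_sq r f).tsum_eq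
    have s2 := (hasSum_repr_sq r (adjoint M f)).tsum_eq
    simp_rw [hf] at s1
    simp_rw [hg] at s2
    change ∑' n, ‖inner ℂ x (v (adjoint A h) n)‖ ^ 2 ≤ ‖M‖ ^ 2 * ∑' n, ‖inner ℂ x (v h n)‖ ^ 2
    rw [s1, s2, ← mul_pow]
    gcongr
    have := le_opNorm (adjoint M) f
    rwa [LinearIsometryEquiv.norm_map] at this
  have hr : 0 < 1 - (r : ℝ) ^ 2 := by nlinarith
  have : ‖adjoint A h‖ ^ 2 ≤ (‖M‖ * ‖h‖) ^ 2 := by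
    rw [mul_pow]
    refine le_of_mul_le_mul_left ?_ hr
    linarith
  exact le_of_sq_le_sq this (by positivity)

end

/-! ### A unitary times a two-valued diagonal operator, and its membership in F_r -/

section Diagonal

variable {K : Type u} [NormedAddCommGroup K] [InnerProductSpace ℂ K]

/-- The operator `p` on `N` and `q` on the orthogonal complement of `N`. -/
noncomputable def twoValueOp (N : Submodule ℂ K) [N.HasOrthogonalProjection] (p q : ℝ) :
    K →L[ℂ] K :=
  (p : ℂ) • N.starProjection + (q : ℂ) • Nᗮ.starProjection

variable (N : Submodule ℂ K) [N.HasOrthogonalProjection]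

theorem starProjection_orthogonal_apply_starProjection (x : K) :
    Nᗮ.starProjection (N.starProjection x) = 0 := by
  rw [Submodule.starProjection_apply_eq_zero_iff]
  exact Submodule.le_orthogonal_orthogonal N (N.starProjection_apply_mem x)

theorem starProjection_apply_starProjection_orthogonal (x : K) :
    N.starProjection (Nᗮ.starProjection x) = 0 := by
  rw [Submodule.starProjection_apply_eq_zero_iff]
  exact Nᗮ.starProjection_apply_mem x

theorem twoValueOp_apply (p q : ℝ) (x : K) : twoValueOp N p q x
    = (p : ℂ) • N.starProjection x + (q : ℂ) • Nᗮ.starProjection x := rfl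

theorem starProjection_twoValueOp (p q : ℝ) (x : K) :
    N.starProjection (twoValueOp N p q x) = (p : ℂ) • N.starProjection x := by
  rw [twoValueOp_apply, map_add, map_smul, map_smul,
    starProjection_apply_starProjection_orthogonal, smul_zero, add_zero,
    Submodule.starProjection_eq_self_iff.2 (N.starProjection_apply_mem x)]

theorem starProjection_orthogonal_twoValueOp (p q : ℝ) (x : K) :
    Nᗮ.starProjection (twoValueOp N p q x) = (q : ℂ) • Nᗮ.starProjection x := by
  rw [twoValueOp_apply, map_add, map_smul, map_smul,
    starProjection_orthogonal_apply_starProjection, smul_zero, zero_add,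
    Submodule.starProjection_eq_self_iff.2 (Nᗮ.starProjection_apply_mem x)]

theorem norm_twoValueOp_sq (p q : ℝ) (x : K) : ‖twoValueOp N p q x‖ ^ 2
    = p ^ 2 * ‖N.starProjection x‖ ^ 2 + q ^ 2 * ‖Nᗮ.starProjection x‖ ^ 2 := by
  rw [N.norm_sq_eq_add_norm_sq_starProjection, starProjection_twoValueOp,
    starProjection_orthogonal_twoValueOp]
  simp only [norm_smul, Complex.norm_real, Real.norm_eq_abs, mul_pow, sq_abs]

theorem twoValueOp_mul (p q p' q' : ℝ) :
    twoValueOp N p q * twoValueOp N p' q' = twoValueOp N (p * p') (q * q') := by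
  ext x
  change twoValueOp N p q (twoValueOp N p' q' x) = _
  rw [twoValueOp_apply N p q, starProjection_twoValueOp, starProjection_orthogonal_twoValueOp,
    twoValueOp_apply, smul_smul, smul_smul, Complex.ofReal_mul, Complex.ofReal_mul]

theorem twoValueOp_one : twoValueOp N 1 1 = 1 := by
  ext x
  simp [twoValueOp_apply]

theorem adjoint_twoValueOp [CompleteSpace K] (p q : ℝ) : adjoint (twoValueOp N p q) = twoValueOp N p q := by
  rw [twoValueOp, map_add, LinearIsometryEquiv.map_smulₛₗ, LinearIsometryEquiv.map_smulₛₗ,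
    Complex.conj_ofReal, Complex.conj_ofReal, (isSelfAdjoint_starProjection N).adjoint_eq,
    (isSelfAdjoint_starProjection Nᗮ).adjoint_eq]

theorem norm_twoValueOp_le {p q c : ℝ} (hp : 0 ≤ p) (hq : 0 ≤ q) (hpc : p ≤ c) (hqc : q ≤ c) :
    ‖twoValueOp N p q‖ ≤ c := by
  refine opNorm_le_bound _ (hp.trans hpc) fun x => ?_
  refine le_of_sq_le_sq ?_ (mul_nonneg (hp.trans hpc) (norm_nonneg _))
  rw [norm_twoValueOp_sq, mul_pow, N.norm_sq_eq_add_norm_sq_starProjection x, mul_add]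
  gcongr

/-- If a unitary maps `N` into itself, then its adjoint does not increase projections to `N`. -/
theorem norm_starProjection_symm_le (U : K ≃ₗᵢ[ℂ] K) (hU : ∀ x ∈ N, U x ∈ N) (x : K) :
    ‖N.starProjection (U.symm x)‖ ≤ ‖N.starProjection x‖ := by
  -- Since U y lies in N, ‖y‖² = ⟨U y, x⟩ is also the pairing of U y with the projection of x, and
  -- the Cauchy–Schwarz inequality applies.
  set y := N.starProjection (U.symm x) with hy
  have hyN : y ∈ N := N.starProjection_apply_mem _
  have h1 : inner ℂ (U y) (N.starProjection x) = inner ℂ (U y) x := by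
    rw [← N.inner_starProjection_left_eq_right,
      Submodule.starProjection_eq_self_iff.2 (hU y hyN)]
  have h2 : inner ℂ (U y) x = ((‖y‖ ^ 2 : ℝ) : ℂ) := by
    have : inner ℂ (U y) x = inner ℂ y (U.symm x) := by
      rw [← U.symm.inner_map_map, U.symm_apply_apply]
    rw [this]
    have h3 : inner ℂ y (U.symm x) = inner ℂ y y := by
      conv_rhs => rw [hy]
      rw [← hy, ← N.inner_starProjection_left_eq_right,
        Submodule.starProjection_eq_self_iff.2 hyN]
    rw [h3, inner_self_eq_norm_sq_to_K]
    norm_cast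
  have h3 := norm_inner_le_norm (𝕜 := ℂ) (U y) (N.starProjection x)
  rw [h1, h2, Complex.norm_real, Real.norm_of_nonneg (sq_nonneg _), U.norm_map, sq] at h3
  rcases (norm_nonneg y).eq_or_lt with h0 | h0
  · rw [← h0]; exact norm_nonneg _
  · exact le_of_mul_le_mul_left h3 h0

/-- The invertible operator `x ↦ U (twoValueOp N p q x)`. -/
noncomputable def twoValueUnit (U : K ≃ₗᵢ[ℂ] K) {p q : ℝ} (hp : 0 < p) (hq : 0 < q) :
    (K →L[ℂ] K)ˣ where
  val := (U : K →L[ℂ] K) * twoValueOp N p q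
  inv := twoValueOp N p⁻¹ q⁻¹ * (U.symm : K →L[ℂ] K)
  val_inv := by
    rw [mul_assoc, ← mul_assoc (twoValueOp N p q), twoValueOp_mul, mul_inv_cancel₀ hp.ne',
      mul_inv_cancel₀ hq.ne', twoValueOp_one, one_mul]
    ext x
    exact U.apply_symm_apply x
  inv_val := by
    rw [mul_assoc, ← mul_assoc (U.symm : K →L[ℂ] K)]
    have : (U.symm : K →L[ℂ] K) * (U : K →L[ℂ] K) = 1 := by
      ext x
      exact U.symm_apply_apply x
    rw [this, one_mul, twoValueOp_mul, inv_mul_cancel₀ hp.ne',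
      inv_mul_cancel₀ hq.ne', twoValueOp_one]

theorem norm_mul_isometry_le {U : K ≃ₗᵢ[ℂ] K} {A : K →L[ℂ] K} :
    ‖(U : K →L[ℂ] K) * A‖ ≤ ‖A‖ ∧ ‖A * (U : K →L[ℂ] K)‖ ≤ ‖A‖ := by
  refine ⟨opNorm_le_bound _ (norm_nonneg _) fun x => ?_,
    opNorm_le_bound _ (norm_nonneg _) fun x => ?_⟩
  · change ‖U (A x)‖ ≤ _
    rw [U.norm_map]
    exact A.le_opNorm x
  · change ‖A (U x)‖ ≤ _
    exact (A.le_opNorm _).trans_eq (by rw [U.norm_map])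

/-- For T = UE, with E equal to t on N and r/t on its complement, TT* = U E² U* and T⁻¹(T⁻¹)* = E⁻².
As r² E⁻² merely interchanges the values t² and (r/t)² of E², the two terms would add up to t² +
(r/t)² if U commuted with the projection. Because U maps N into itself, the discrepancy has the
favourable sign. -/
theorem twoValueUnit_mem_classF [CompleteSpace K] [Nontrivial K] (U : K ≃ₗᵢ[ℂ] K) (hU : ∀ x ∈ N, U x ∈ N)
    {r t : ℝ} (h0 : 0 < r) (hr : r < t ^ 2) (ht0 : 0 < t) (ht : t < 1) :
    ((twoValueUnit N U ht0 (div_pos h0 ht0) : (K →L[ℂ] K)ˣ) : K →L[ℂ] K) ∈ classF r K := by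
  set u := twoValueUnit N U ht0 (div_pos h0 ht0) with hu
  have hval : (u : K →L[ℂ] K) = (U : K →L[ℂ] K) * twoValueOp N t (r / t) := rfl
  have hinv : ((u⁻¹ : (K →L[ℂ] K)ˣ) : K →L[ℂ] K)
      = twoValueOp N t⁻¹ (r / t)⁻¹ * (U.symm : K →L[ℂ] K) := rfl
  have hrt : r / t ≤ t := by rw [div_le_iff₀ ht0]; nlinarith
  have hrt0 : 0 < r / t := div_pos h0 ht0
  have hn1 : ‖(u : K →L[ℂ] K)‖ ≤ t :=
    norm_mul_isometry_le.1.trans (norm_twoValueOp_le N ht0.le hrt0.le le_rfl hrt)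
  have hn2 : ‖((u⁻¹ : (K →L[ℂ] K)ˣ) : K →L[ℂ] K)‖ ≤ (r / t)⁻¹ :=
    (norm_mul_isometry_le (U := U.symm)).2.trans
      (norm_twoValueOp_le N (by positivity) (by positivity) (inv_anti₀ hrt0 hrt) le_rfl)
  have hadj : adjoint (U : K →L[ℂ] K) = (U.symm : K →L[ℂ] K) := U.adjoint_eq_symm
  have hadj' : adjoint (U.symm : K →L[ℂ] K) = (U : K →L[ℂ] K) := by
    rw [← hadj, adjoint_adjoint]
  refine ⟨fun z hz => ⟨?_, ((spectrum.norm_le_norm_of_mem hz).trans hn1).trans_lt ht⟩, ?_⟩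
  · have hz' := spectrum.norm_le_norm_of_mem (spectrum.inv₀_mem_inv_iff.2 hz)
    rw [norm_inv] at hz'
    have hz0 : z ≠ 0 := by
      rintro rfl
      exact (spectrum.zero_notMem_iff ℂ).2 u.isUnit hz
    have h3 := (inv_le_inv₀ (norm_pos_iff.2 hz0) hrt0).1 (hz'.trans hn2)
    refine lt_of_lt_of_le ?_ h3
    rw [lt_div_iff₀ ht0]
    nlinarith
  · rw [ContinuousLinearMap.le_def, Ring.inverse_unit, isPositive_iff_complex]
    intro x
    have hT : ∀ y, adjoint (u : K →L[ℂ] K) y = twoValueOp N t (r / t) (U.symm y) := by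
      intro y
      rw [hval, ← star_eq_adjoint, star_mul, star_eq_adjoint, star_eq_adjoint, hadj,
        adjoint_twoValueOp]
      rfl
    have hTi : ∀ y, adjoint ((u⁻¹ : (K →L[ℂ] K)ˣ) : K →L[ℂ] K) y
        = U (twoValueOp N t⁻¹ (r / t)⁻¹ y) := by
      intro y
      rw [hinv, ← star_eq_adjoint, star_mul, star_eq_adjoint, star_eq_adjoint, hadj',
        adjoint_twoValueOp]
      rfl
    have key : inner ℂ ((((r : ℂ) ^ 2 + 1) • (1 : K →L[ℂ] K) - (((r : ℂ) ^ 2) •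
        (((u⁻¹ : (K →L[ℂ] K)ˣ) : K →L[ℂ] K) * adjoint ((u⁻¹ : (K →L[ℂ] K)ˣ) : K →L[ℂ] K))
        + (u : K →L[ℂ] K) * adjoint (u : K →L[ℂ] K))) x) x
        = (((r ^ 2 + 1) * ‖x‖ ^ 2 - (r ^ 2 * ‖adjoint ((u⁻¹ : (K →L[ℂ] K)ˣ) : K →L[ℂ] K) x‖ ^ 2
          + ‖adjoint (u : K →L[ℂ] K) x‖ ^ 2) : ℝ) : ℂ) := by
      simp only [sub_apply, smul_apply, add_apply, FunLike.coe_mul_eq_comp, Function.comp_apply,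
        one_apply_eq_self, inner_sub_left, inner_add_left, inner_smul_left]
      simp only [← adjoint_inner_right, inner_self_eq_norm_sq_to_K]
      simp
    rw [key]
    refine ⟨congrArg Complex.ofReal (Complex.ofReal_re _), ?_⟩
    rw [RCLike.re_eq_complex_re, Complex.ofReal_re, hT, hTi, U.norm_map, norm_twoValueOp_sq,
      norm_twoValueOp_sq, N.norm_sq_eq_add_norm_sq_starProjection x]
    have e1 := norm_starProjection_symm_le N U hU x
    have e2 : ‖x‖ ^ 2 = ‖N.starProjection (U.symm x)‖ ^ 2 + ‖Nᗮ.starProjection (U.symm x)‖ ^ 2 := by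
      rw [← N.norm_sq_eq_add_norm_sq_starProjection, U.symm.norm_map]
    have e3 := N.norm_sq_eq_add_norm_sq_starProjection x
    have e4 : ‖N.starProjection (U.symm x)‖ ^ 2 ≤ ‖N.starProjection x‖ ^ 2 := by gcongr
    generalize ‖N.starProjection (U.symm x)‖ ^ 2 = p' at *
    generalize ‖Nᗮ.starProjection (U.symm x)‖ ^ 2 = q' at *
    have hp0 : 0 ≤ ‖N.starProjection x‖ ^ 2 := sq_nonneg _
    have hq0 : 0 ≤ ‖Nᗮ.starProjection x‖ ^ 2 := sq_nonneg _
    generalize ‖N.starProjection x‖ ^ 2 = p at *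
    generalize ‖Nᗮ.starProjection x‖ ^ 2 = q at *
    have e5 : q' = p + q - p' := by linarith
    have e6 : r ^ 2 * (t⁻¹ ^ 2 * p + (r / t)⁻¹ ^ 2 * q) = (r / t) ^ 2 * p + t ^ 2 * q := by
      field_simp
    have e7 : (r / t) ^ 2 ≤ t ^ 2 := pow_le_pow_left₀ hrt0.le hrt 2
    -- This is (1 - t²)(t² - r²) ≥ 0 divided by t².
    have e8 : t ^ 2 + (r / t) ^ 2 ≤ r ^ 2 + 1 := by
      rw [div_pow]
      have : r ^ 2 / t ^ 2 * t ^ 2 = r ^ 2 := by field_simp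
      have ht2 : 0 < t ^ 2 := by positivity
      have hrr : r ^ 2 ≤ t ^ 2 := by
        have : r < 1 := by nlinarith
        nlinarith
      have ht3 : t ^ 2 ≤ 1 := by nlinarith
      refine le_of_mul_le_mul_right ?_ ht2
      rw [add_mul, this]
      nlinarith [mul_nonneg (sub_nonneg.2 ht3) (sub_nonneg.2 hrr)]
    rw [e6, e5]
    -- The left side equals (t² + (r/t)²)(p + q) - (t² - (r/t)²)(p - p').
    nlinarith [mul_nonneg (sub_nonneg.2 e7) (sub_nonneg.2 e4),
      mul_nonneg (sub_nonneg.2 e8) (add_nonneg hp0 hq0)]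

end Diagonal

/-! ### Weighted bilateral shifts approximating M_z -/

/-- An operator that is a limit, entry by entry, of operators of norm at most `B`, has norm at most
`B`. -/
theorem opNorm_le_of_tendsto_entries {ι E K β : Type*} [NormedAddCommGroup E]
    [InnerProductSpace ℂ E] [NormedAddCommGroup K] [InnerProductSpace ℂ K]
    (e : HilbertBasis ι ℂ E) (b : HilbertBasis ι ℂ K) (M : E →L[ℂ] E) (A : β → K →L[ℂ] K)
    {l : Filter β} [l.NeBot] {B : ℝ} (hB : 0 ≤ B) (hA : ∀ᶠ t in l, ‖A t‖ ≤ B)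
    (h : ∀ k n, Tendsto (fun t => inner ℂ (b k) (A t (b n))) l (𝓝 (inner ℂ (e k) (M (e n))))) :
    ‖M‖ ≤ B := by
  classical
  let J : E ≃ₗᵢ[ℂ] K := e.repr.trans b.repr.symm
  have hJ : ∀ n, J (e n) = b n := fun n => by
    simp [J, HilbertBasis.repr_self]
  have hspan : ∀ x ∈ Submodule.span ℂ (Set.range e), ∀ y ∈ Submodule.span ℂ (Set.range e),
      Tendsto (fun t => inner ℂ (J y) (A t (J x))) l (𝓝 (inner ℂ y (M x))) := by
    intro x hx y hy
    induction hx using Submodule.span_induction with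
    | mem x hx =>
      obtain ⟨n, rfl⟩ := hx
      induction hy using Submodule.span_induction with
      | mem y hy =>
        obtain ⟨k, rfl⟩ := hy
        rw [hJ, hJ]
        exact h k n
      | zero => simp
      | add y y' _ _ h1 h2 => simpa [inner_add_left] using h1.add h2
      | smul c y _ h1 => simpa [inner_smul_left] using h1.mul_const (conj c)
    | zero => simp
    | add x x' _ _ h1 h2 => simpa [inner_add_right] using h1.add h2
    | smul c x _ h1 => simpa [inner_smul_right] using h1.const_mul c
  have hbound : ∀ x ∈ Submodule.span ℂ (Set.range e), ∀ y ∈ Submodule.span ℂ (Set.range e),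
      ‖inner ℂ y (M x)‖ ≤ B * ‖x‖ * ‖y‖ := by
    intro x hx y hy
    refine le_of_tendsto (hspan x hx y hy).norm ?_
    filter_upwards [hA] with t ht
    calc _ ≤ ‖J y‖ * ‖A t (J x)‖ := norm_inner_le_norm _ _
      _ ≤ ‖J y‖ * (B * ‖J x‖) := by gcongr; exact (A t).le_of_opNorm_le ht _
      _ = B * ‖x‖ * ‖y‖ := by rw [J.norm_map, J.norm_map]; ring
  have hdense : Dense (Submodule.span ℂ (Set.range e) : Set E) :=
    Submodule.dense_iff_topologicalClosure_eq_top.2 e.dense_span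
  have h1 : ∀ x ∈ Submodule.span ℂ (Set.range e), ∀ y, ‖inner ℂ y (M x)‖ ≤ B * ‖x‖ * ‖y‖ := by
    intro x hx y
    exact hdense.induction (P := fun y => ‖inner ℂ y (M x)‖ ≤ B * ‖x‖ * ‖y‖) (hbound x hx)
      (isClosed_le (by fun_prop) (by fun_prop)) y
  have h2 : ∀ x y, ‖inner ℂ y (M x)‖ ≤ B * ‖x‖ * ‖y‖ := by
    intro x y
    exact hdense.induction (P := fun x => ‖inner ℂ y (M x)‖ ≤ B * ‖x‖ * ‖y‖)
      (fun x hx => h1 x hx y) (isClosed_le (by fun_prop) (by fun_prop)) x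
  refine opNorm_le_bound _ hB fun x => ?_
  have h3 := h2 x (M x)
  rw [inner_self_eq_norm_sq_to_K, norm_pow, RCLike.norm_ofReal, abs_norm, sq] at h3
  rcases (norm_nonneg (M x)).eq_or_lt with h0 | h0
  · rw [← h0]; positivity
  · exact le_of_mul_le_mul_right h3 h0

/-- `calcNorms` ranges over Hilbert spaces in the universe `u`, so the model space for the shifts
has to be lifted there. -/
theorem exists_hilbertBasis_int : ∃ (K : Type u) (_ : NormedAddCommGroup K)
    (_ : InnerProductSpace ℂ K) (_ : CompleteSpace K), Nonempty (HilbertBasis ℤ ℂ K) := by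
  let K := lp (fun _ : ULift.{u} ℤ => ℂ) 2
  let b : HilbertBasis (ULift.{u} ℤ) ℂ K := HilbertBasis.ofRepr (LinearIsometryEquiv.refl ℂ K)
  refine ⟨K, inferInstance, inferInstance, inferInstance,
    ⟨HilbertBasis.mk (v := b ∘ ULift.up) (b.orthonormal.comp _ ULift.up_injective) ?_⟩⟩
  rw [Set.range_comp, Set.range_eq_univ.2 ULift.up_surjective, Set.image_univ, b.dense_span]

section Shift

variable {K : Type u} [NormedAddCommGroup K] [InnerProductSpace ℂ K] [CompleteSpace K]

theorem exists_bilateralShift (b : HilbertBasis ℤ ℂ K) :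
    ∃ U : K ≃ₗᵢ[ℂ] K, ∀ n, U (b n) = b (n + 1) := by
  classical
  have hr : Set.range (fun n : ℤ => n + 1) = Set.univ :=
    (Equiv.addRight (1 : ℤ)).surjective.range_eq
  let b' : HilbertBasis ℤ ℂ K := HilbertBasis.mk (v := b ∘ fun n => n + 1)
    (b.orthonormal.comp _ (add_left_injective 1)) (by
      rw [Set.range_comp, hr, Set.image_univ, b.dense_span])
  refine ⟨b.repr.trans b'.repr.symm, fun n => ?_⟩
  rw [LinearIsometryEquiv.trans_apply, HilbertBasis.repr_self, HilbertBasis.repr_symm_single,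
    HilbertBasis.coe_mk]
  rfl

/-- The closed span of the basis vectors of nonnegative index. -/
noncomputable def nonnegSpan (b : HilbertBasis ℤ ℂ K) : Submodule ℂ K :=
  (Submodule.span ℂ (b '' Set.Ici 0)).topologicalClosure

instance (b : HilbertBasis ℤ ℂ K) : (nonnegSpan b).HasOrthogonalProjection :=
  have : CompleteSpace (nonnegSpan b) :=
    (Submodule.isClosed_topologicalClosure _).completeSpace_coe
  inferInstance

omit [CompleteSpace K] in
theorem map_mem_nonnegSpan {b : HilbertBasis ℤ ℂ K} {U : K ≃ₗᵢ[ℂ] K}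
    (hU : ∀ n, U (b n) = b (n + 1)) : ∀ x ∈ nonnegSpan b, U x ∈ nonnegSpan b := by
  have : nonnegSpan b ≤ (nonnegSpan b).comap (U : K →ₗ[ℂ] K) := by
    refine Submodule.topologicalClosure_minimal _ (Submodule.span_le.2 ?_)
      ((Submodule.isClosed_topologicalClosure _).preimage U.continuous)
    rintro _ ⟨n, hn, rfl⟩
    refine Submodule.le_topologicalClosure _ (Submodule.subset_span ⟨n + 1, ?_, (hU n).symm⟩)
    simp only [Set.mem_Ici] at hn ⊢
    omega
  exact this

theorem twoValueOp_basis (b : HilbertBasis ℤ ℂ K) (p q : ℝ) (n : ℤ) :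
    twoValueOp (nonnegSpan b) p q (b n) = ((if 0 ≤ n then p else q : ℝ) : ℂ) • b n := by
  rw [twoValueOp_apply]
  split_ifs with hn
  · have hmem : b n ∈ nonnegSpan b :=
      Submodule.le_topologicalClosure _ (Submodule.subset_span ⟨n, hn, rfl⟩)
    rw [Submodule.starProjection_eq_self_iff.2 hmem,
      (Submodule.starProjection_apply_eq_zero_iff _).2
        (Submodule.le_orthogonal_orthogonal _ hmem), smul_zero, add_zero]
  · have hmem : b n ∈ (nonnegSpan b)ᗮ := by
      rw [nonnegSpan, Submodule.orthogonal_closure, Submodule.mem_orthogonal]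
      intro x hx
      induction hx using Submodule.span_induction with
      | mem x hx =>
        obtain ⟨m, hm, rfl⟩ := hx
        refine b.orthonormal.2 ?_
        rintro rfl
        exact hn hm
      | zero => exact inner_zero_left _
      | add x y _ _ hx hy => rw [inner_add_left, hx, hy, add_zero]
      | smul c x _ hx => rw [inner_smul_left, hx, mul_zero]
    rw [Submodule.starProjection_eq_self_iff.2 hmem,
      (Submodule.starProjection_apply_eq_zero_iff _).2 hmem, smul_zero, zero_add]

/-- The weights along which the operator `twoValueUnit` is a shift. -/
noncomputable def shiftWeight (r t : ℝ) (n : ℤ) : ℝ := t⁻¹ ^ n.toNat * (r / t) ^ (-n).toNat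

theorem shiftWeight_pos {r t : ℝ} (h0 : 0 < r) (ht : 0 < t) (n : ℤ) : 0 < shiftWeight r t n := by
  unfold shiftWeight; positivity

theorem shiftWeight_succ (r : ℝ) {t : ℝ} (ht : 0 < t) (n : ℤ) :
    (if 0 ≤ n then t else r / t) * shiftWeight r t (n + 1) = shiftWeight r t n := by
  unfold shiftWeight
  split_ifs with hn
  · obtain ⟨m, rfl⟩ := Int.eq_ofNat_of_zero_le hn
    have e1 : ((m : ℤ) + 1).toNat = m + 1 := by omega
    have e2 : (-((m : ℤ) + 1)).toNat = 0 := by omega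
    have e3 : (-(m : ℤ)).toNat = 0 := by omega
    rw [e1, e2, e3, Int.toNat_natCast, pow_succ]
    field_simp
  · obtain ⟨m, hm⟩ := Int.eq_ofNat_of_zero_le (show 0 ≤ -n - 1 by omega)
    obtain rfl : n = -((m : ℤ) + 1) := by omega
    have e1 : (-((m : ℤ) + 1) + 1).toNat = 0 := by omega
    have e2 : (-(-((m : ℤ) + 1) + 1)).toNat = m := by omega
    have e3 : (-(-((m : ℤ) + 1))).toNat = m + 1 := by omega
    have e4 : (-((m : ℤ) + 1)).toNat = 0 := by omega
    rw [e1, e2, e3, e4, pow_succ]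
    ring

/-- At t = 1 the weights of the shift are those of the normalized monomials, so the model operator
degenerates to M_z. -/
theorem tendsto_shiftWeight (r : ℝ) (n : ℤ) :
    Tendsto (fun t => shiftWeight r t n) (𝓝[<] 1) (𝓝 (monomialWeight r n)) := by
  have h : ContinuousAt (fun t => shiftWeight r t n) 1 := by
    unfold shiftWeight
    refine ContinuousAt.mul ?_ ?_
    · exact (continuousAt_id.inv₀ one_ne_zero).pow _
    · exact (continuousAt_const.div continuousAt_id one_ne_zero).pow _
  have := h.tendsto.mono_left (nhdsWithin_le_nhds (s := Set.Iio (1 : ℝ)))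
  simpa [shiftWeight, monomialWeight] using this

theorem twoValueUnit_zpow_basis {b : HilbertBasis ℤ ℂ K} {U : K ≃ₗᵢ[ℂ] K}
    (hU : ∀ n, U (b n) = b (n + 1)) {r t : ℝ} (h0 : 0 < r) (ht0 : 0 < t) (m n : ℤ) :
    ((twoValueUnit (nonnegSpan b) U ht0 (div_pos h0 ht0) ^ m : (K →L[ℂ] K)ˣ) : K →L[ℂ] K) (b n)
      = ((shiftWeight r t n / shiftWeight r t (n + m) : ℝ) : ℂ) • b (n + m) := by
  set u := twoValueUnit (nonnegSpan b) U ht0 (div_pos h0 ht0) with hu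
  have hw : ∀ k, (shiftWeight r t k : ℂ) ≠ 0 := fun k => by
    exact_mod_cast (shiftWeight_pos h0 ht0 k).ne'
  -- These rescaled basis vectors are moved by the operator without any weight, so its integer
  -- powers are read off at once.
  let g : ℤ → K := fun k => ((shiftWeight r t k : ℂ))⁻¹ • b k
  have hg : ∀ k, (u : K →L[ℂ] K) (g k) = g (k + 1) := by
    intro k
    have : (u : K →L[ℂ] K) (b k) = ((if 0 ≤ k then t else r / t : ℝ) : ℂ) • b (k + 1) := by
      change U (twoValueOp _ _ _ (b k)) = _
      rw [twoValueOp_basis, map_smul, hU]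
    simp only [g, map_smul, this, smul_smul]
    congr 1
    rw [← shiftWeight_succ r ht0 k]
    have h1 := hw (k + 1)
    have h2 : ((if 0 ≤ k then t else r / t : ℝ) : ℂ) ≠ 0 := by
      have : 0 < (if 0 ≤ k then t else r / t : ℝ) := by split_ifs <;> positivity
      exact_mod_cast this.ne'
    rw [Complex.ofReal_mul]
    field_simp
  have hgi : ∀ k, ((u⁻¹ : (K →L[ℂ] K)ˣ) : K →L[ℂ] K) (g k) = g (k - 1) := by
    intro k
    have h1 := hg (k - 1)
    rw [sub_add_cancel] at h1
    rw [← h1]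
    exact congrArg (fun A : K →L[ℂ] K => A (g (k - 1))) u.inv_mul
  have hpow : ∀ m : ℤ, ∀ k, ((u ^ m : (K →L[ℂ] K)ˣ) : K →L[ℂ] K) (g k) = g (k + m) := by
    intro m
    induction m with
    | zero => intro k; simp
    | succ m ih =>
      intro k
      rw [zpow_add_one, Units.val_mul, FunLike.coe_mul_eq_comp, Function.comp_apply, hg, ih]
      congr 1; ring
    | pred m ih =>
      intro k
      rw [zpow_sub_one, Units.val_mul, FunLike.coe_mul_eq_comp, Function.comp_apply, hgi, ih]
      congr 1; ring
  have hb : b n = (shiftWeight r t n : ℂ) • g n := by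
    simp only [g, smul_smul, mul_inv_cancel₀ (hw n), one_smul]
  conv_lhs => rw [hb]
  rw [map_smul, hpow]
  simp only [g, smul_smul, div_eq_mul_inv, Complex.ofReal_mul, Complex.ofReal_inv]

theorem inner_funcCalc_twoValueUnit (r : Set.Ioo (0 : ℝ) 1) {φ : ℂ → ℂ} (hφ : MemHInfty r φ)
    {b : HilbertBasis ℤ ℂ K} {U : K ≃ₗᵢ[ℂ] K} (hU : ∀ n, U (b n) = b (n + 1)) {t : ℝ}
    (ht0 : 0 < t) (hT : ((twoValueUnit (nonnegSpan b) U ht0 (div_pos r.2.1 ht0) :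
      (K →L[ℂ] K)ˣ) : K →L[ℂ] K) ∈ classF (r : ℝ) K) (k n : ℤ) :
    inner ℂ (b k) (funcCalc (r : ℝ) φ ((twoValueUnit (nonnegSpan b) U ht0 (div_pos r.2.1 ht0) :
      (K →L[ℂ] K)ˣ) : K →L[ℂ] K) (b n))
      = laurentCoeff r φ (k - n) * ((shiftWeight r t n / shiftWeight r t k : ℝ) : ℂ) := by
  classical
  have hsum := (summable_laurentTerm r hφ hT).hasSum
  rw [← funcCalc] at hsum
  have h1 := ((innerSL ℂ (b k)).comp (ContinuousLinearMap.apply ℂ K (b n))).hasSum hsum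
  refine h1.unique ?_
  have h2 : ∀ m, ((innerSL ℂ (b k)).comp (ContinuousLinearMap.apply ℂ K (b n)))
      (laurentTerm (r : ℝ) φ ((twoValueUnit (nonnegSpan b) U ht0 (div_pos r.2.1 ht0) :
      (K →L[ℂ] K)ˣ) : K →L[ℂ] K) m) = if m = k - n then
        laurentCoeff r φ (k - n) * ((shiftWeight r t n / shiftWeight r t k : ℝ) : ℂ) else 0 := by
    intro m
    rw [laurentTerm, opZPow_units, comp_apply, ContinuousLinearMap.apply_apply, smul_apply,
      twoValueUnit_zpow_basis hU r.2.1, innerSL_apply_apply, inner_smul_right, inner_smul_right,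
      orthonormal_iff_ite.1 b.orthonormal]
    by_cases hm : m = k - n
    · subst hm
      simp
    · rw [if_neg hm, if_neg (by omega), mul_zero, mul_zero]
  simp_rw [h2]
  exact hasSum_ite_eq _ _

end Shift

theorem multNorm_le_of_mem_upperBounds (r : Set.Ioo (0 : ℝ) 1) {φ : ℂ → ℂ} (hφ : MemHInfty r φ)
    {B : ℝ} (hB : B ∈ upperBounds (calcNorms.{u} r φ)) :
    multNorm (AnnulusSpace r) (fun z : annulus (r : ℝ) => φ z) ≤ B := by
  obtain ⟨K, _, _, _, ⟨b⟩⟩ := exists_hilbertBasis_int.{u}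
  have : Nontrivial K := ⟨b 0, 0, b.orthonormal.ne_zero 0⟩
  obtain ⟨U, hU⟩ := exists_bilateralShift b
  have h0 := r.2.1
  have h1 := r.2.2
  have hs1 : √(r : ℝ) < 1 := by
    rw [Real.sqrt_lt' one_pos]; simpa using h1
  have hs0 : 0 < √(r : ℝ) := Real.sqrt_pos.2 h0
  have hmem : ∀ t ∈ Set.Ioo (√(r : ℝ)) 1, ∀ ht0 : 0 < t,
      ((twoValueUnit (nonnegSpan b) U ht0 (div_pos h0 ht0) : (K →L[ℂ] K)ˣ) : K →L[ℂ] K)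
        ∈ classF (r : ℝ) K := fun t ht ht0 =>
    twoValueUnit_mem_classF _ U (map_mem_nonnegSpan hU) h0 ((Real.sqrt_lt' ht0).1 ht.1) ht0 ht.2
  let A : ℝ → K →L[ℂ] K := fun t => if ht : 0 < t then
    funcCalc (r : ℝ) φ ((twoValueUnit (nonnegSpan b) U ht (div_pos h0 ht) :
      (K →L[ℂ] K)ˣ) : K →L[ℂ] K) else 0
  have hA : ∀ t ∈ Set.Ioo (√(r : ℝ)) 1, ‖A t‖ ≤ B := fun t ht => by
    have ht0 := hs0.trans ht.1
    refine hB ⟨K, _, _, ‹_›, _, hmem t ht ht0, ?_⟩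
    simp only [A, dif_pos ht0]
  have hev := Ioo_mem_nhdsLT hs1
  -- B bounds the norm of at least one actual operator, since the interval (√r, 1) is not empty.
  have hB0 : 0 ≤ B := by
    obtain ⟨t, ht⟩ := exists_between hs1
    exact (norm_nonneg _).trans (hA t ht)
  refine opNorm_le_of_tendsto_entries (annulusBasis r) b _ A hB0
    (l := 𝓝[<] 1) (Filter.mem_of_superset hev hA) fun k n => ?_
  rw [inner_multOp r hφ]
  have hlim := (Complex.continuous_ofReal.tendsto _).comp
    ((tendsto_shiftWeight r n).div (tendsto_shiftWeight r k) (monomialWeight_pos h0 k).ne')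
  refine (hlim.const_mul (laurentCoeff r φ (k - n))).congr' ?_
  filter_upwards [hev] with t ht
  have ht0 := hs0.trans ht.1
  simp only [A, dif_pos ht0]
  rw [inner_funcCalc_twoValueUnit r hφ hU ht0 (hmem t ht ht0)]
  rfl

theorem isLUB_calcNorms (r : Set.Ioo (0 : ℝ) 1) {φ : ℂ → ℂ} (hφ : MemHInfty r φ) :
    IsLUB (calcNorms.{u} r φ) (multNorm (AnnulusSpace r) (fun z : annulus (r : ℝ) => φ z)) := by
  refine ⟨?_, fun B hB => multNorm_le_of_mem_upperBounds r hφ hB⟩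
  rintro _ ⟨H, _, _, _, T, hT, rfl⟩
  exact norm_funcCalc_le r hφ hT

/-! ### Sharpness of √2 -/

/-- The extremal functions `z ^ N + (r / z) ^ N`. -/
theorem memHInfty_pow_add_div_pow (r : Set.Ioo (0 : ℝ) 1) (N : ℕ) :
    MemHInfty r (fun z => z ^ N + ((r : ℝ) / z) ^ N) ∧
      supNorm r (fun z => z ^ N + ((r : ℝ) / z) ^ N) ≤ 1 + (r : ℝ) ^ N := by
  have h0 := r.2.1
  have hb : ∀ z ∈ annulus (r : ℝ), ‖z ^ N + ((r : ℝ) / z) ^ N‖ ≤ 1 + (r : ℝ) ^ N := by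
    intro z hz
    have hz0 : 0 < ‖z‖ := h0.trans hz.1
    have h1 : ‖z‖ ^ N ≤ 1 := pow_le_one₀ hz0.le hz.2.le
    have h2 : (r / ‖z‖) ^ N ≤ 1 := pow_le_one₀ (by positivity) ((div_lt_one hz0).2 hz.1).le
    have h3 : ‖z‖ ^ N * (r / ‖z‖) ^ N = (r : ℝ) ^ N := by
      rw [← mul_pow, mul_div_cancel₀ _ hz0.ne']
    calc _ ≤ ‖z‖ ^ N + (r / ‖z‖) ^ N := by
          refine (norm_add_le _ _).trans_eq ?_
          rw [norm_pow, norm_pow, norm_div, Complex.norm_real, Real.norm_of_nonneg h0.le]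
      -- With α = |z|^N and β = (r/|z|)^N, both at most 1 and with product r^N, (1 - α)(1 - β) ≥ 0
      -- gives α + β ≤ 1 + r^N.
      _ ≤ _ := by nlinarith [mul_nonneg (sub_nonneg.2 h1) (sub_nonneg.2 h2)]
  refine ⟨⟨fun z hz => ?_, _, hb⟩, Real.iSup_le (fun z => hb z z.2) (by positivity)⟩
  have hz0 : z ≠ 0 := norm_pos_iff.1 (h0.trans hz.1)
  exact ((differentiableAt_id.pow N).add
    (((differentiableAt_const _).div differentiableAt_id hz0).pow N)).differentiableWithinAt

theorem sqrt_two_le_multNorm (r : Set.Ioo (0 : ℝ) 1) {N : ℕ} (hN : N ≠ 0) :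
    √2 ≤ multNorm (AnnulusSpace r)
      (fun z : annulus (r : ℝ) => (z : ℂ) ^ N + ((r : ℝ) / (z : ℂ)) ^ N) := by
  have hφ := (memHInfty_pow_add_div_pow r N).1
  set b := annulusBasis r with hb
  set M := multOp (AnnulusSpace r)
    (fun z : annulus (r : ℝ) => (z : ℂ) ^ N + ((r : ℝ) / (z : ℂ)) ^ N) with hM
  have h1 : M (b 0) = b N + b (-N) := RKHS.ext fun z => by
    rw [hM, multOp_apply r hφ, RKHS.coe_add, Pi.add_apply, hb, annulusBasis_apply,
      annulusBasis_apply, annulusBasis_apply, monomialWeight_natCast, monomialWeight_neg_natCast]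
    simp [monomialWeight, div_eq_mul_inv, mul_pow]
  have h2 : ‖b N + b (-N)‖ ^ 2 = 2 := by
    have hne : (N : ℤ) ≠ -N := by omega
    rw [sq, norm_add_sq_eq_norm_sq_add_norm_sq_of_inner_eq_zero _ _ (b.orthonormal.2 hne),
      b.orthonormal.1, b.orthonormal.1]
    norm_num
  have h3 := M.le_opNorm (b 0)
  rw [b.orthonormal.1, mul_one, h1] at h3
  rw [multNorm, ← hM]
  refine le_trans (Real.sqrt_le_iff.2 ⟨norm_nonneg _, h2.ge⟩) h3

theorem sqrt_two_le_of_multNorm_le (r : Set.Ioo (0 : ℝ) 1) {C : ℝ}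
    (hC : ∀ φ : ℂ → ℂ, MemHInfty r φ →
      multNorm (AnnulusSpace r) (fun z : annulus (r : ℝ) => φ z) ≤ C * supNorm r φ) :
    √2 ≤ C := by
  -- The exponent N + 1 avoids 0, for which the two basis vectors e_N and e_(-N) coincide.
  have hle : ∀ N : ℕ, √2 ≤ C * supNorm r (fun z => z ^ (N + 1) + ((r : ℝ) / z) ^ (N + 1)) :=
    fun N => (sqrt_two_le_multNorm r (N := N + 1) N.succ_ne_zero).trans
      (hC (fun z => z ^ (N + 1) + ((r : ℝ) / z) ^ (N + 1)) (memHInfty_pow_add_div_pow r (N + 1)).1)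
  -- The sign of C is needed to replace the supremum norm by its upper bound 1 + r^(N+1).
  have hC0 : 0 ≤ C := by
    by_contra! h
    have h1 := hle 0
    have h2 := mul_nonpos_of_nonpos_of_nonneg h.le
      (supNorm_nonneg r (fun z => z ^ (0 + 1) + ((r : ℝ) / z) ^ (0 + 1)))
    have h3 : 0 < √(2 : ℝ) := by positivity
    linarith
  have hlim : Tendsto (fun N : ℕ => C * (1 + (r : ℝ) ^ (N + 1))) atTop (𝓝 C) := by
    have := (((tendsto_add_atTop_iff_nat 1).2
      (tendsto_pow_atTop_nhds_zero_of_lt_one r.2.1.le r.2.2)).const_add 1).const_mul C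
    simpa using this
  exact ge_of_tendsto' hlim fun N => (hle N).trans
    (mul_le_mul_of_nonneg_left (memHInfty_pow_add_div_pow r (N + 1)).2 hC0)

theorem theorem1 (r : Set.Ioo (0 : ℝ) 1) :
    (∀ φ : ℂ → ℂ, MemHInfty r φ →
      (∀ (H : Type u) [NormedAddCommGroup H] [InnerProductSpace ℂ H] [CompleteSpace H],
        ∀ T ∈ classF (r : ℝ) H, Summable (laurentTerm (r : ℝ) φ T)) ∧
      IsMultiplier (AnnulusSpace r) (fun z : annulus (r : ℝ) => φ z) ∧
      IsLUB (calcNorms.{u} r φ)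
        (multNorm (AnnulusSpace r) (fun z : annulus (r : ℝ) => φ z)) ∧
      multNorm (AnnulusSpace r) (fun z : annulus (r : ℝ) => φ z) ≤ Real.sqrt 2 * supNorm r φ) ∧
    (∀ C : ℝ,
      (∀ φ : ℂ → ℂ, MemHInfty r φ →
        multNorm (AnnulusSpace r) (fun z : annulus (r : ℝ) => φ z) ≤ C * supNorm r φ) →
      Real.sqrt 2 ≤ C) :=
  ⟨fun _ hφ => ⟨fun _ _ _ _ _ hT => summable_laurentTerm r hφ hT, isMultiplier_of_memHInfty r hφ,
    isLUB_calcNorms r hφ, multNorm_le r hφ⟩, fun _ hC => sqrt_two_le_of_multNorm_le r hC⟩
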